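/- Elements of a matroid $M$ satisfy $\mathrm{HP}(y,x,z;o,q,r,s)$ if they are seven distinct elements such that $M|\{y,x,z,o,q,r,s\}$ is a simple matroid of rank $3$ whose collinear triples are exactly $yxz$, $yoq$, $yrs$, $zos$, $zqr$, $xqs$ (the non-Fano matroid $F_7^-$), or exactly these together with $xor$ (the Fano matroid $F_7$). An element $x'$ is a harmonic conjugate of $x$ with respect to $y$ and $z$, written $\mathrm{H}(y,z;x,x')$, if there are $o,q,r,s$ with $\mathrm{HP}(y,x,z;o,q,r,s)$ and $\mathrm{cl}(\{y,z\})\cap\mathrm{cl}(\{o,r\})=\{x'\}$. The matroid $M$ is harmonic if for all $y,x,z,o,q,r,s$ with $\mathrm{HP}(y,x,z;o,q,r,s)$ the set $\mathrm{cl}(\{y,z\})\cap\mathrm{cl}(\{o,r\})$ consists of exactly one element, and this element depends only on $x,y,z$. For a set $S$ of elements of $M$ put $h(S)=S\cup\{x : \mathrm{H}(a,c;b,x)\text{ for some }a,b,c\in S\}$ and $h^\infty(S)=\bigcup_{n\ge 0}h^n(S)$ (the harmonic closure of $S$). For a prime $p$, let $L_p$ be the restriction of the matroid $PG(2,p)$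 to the set of points $\{[0,i,1],[1,i,1],[1,i,0] : i\in\mathbb Z_p\}\cup\{[0,1,0]\}$ (the union of three concurrent lines), and for $i,j\in\mathbb Z_p$ let $\langle j,-1,i\rangle_p=\{[0,i,1],[1,i+j,1],[1,j,0]\}$. **Proposition.** Let $p$ be a prime and suppose that $L_p$ is embedded in a harmonic matroid $M$ (that is, $L_p$ is identified with a restriction of $M$). Then for all $i,j\in\mathbb Z_p$ the set $\langle j,-1,i\rangle := h^\infty(\langle j,-1,i\rangle_p)$ satisfies $$\langle j,-1,i\rangle=\mathrm{cl}(\langle j,-1,i\rangle_p)\cap h^\infty(L_p),$$ where $\mathrm{cl}$ is the closure operator of $M$ and $h^\infty$ is taken in $M$. -/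

import Mathlib

open Set

namespace HarmonicMatroid

/-- `φ` embeds the matroid `N` in the matroid `M`: it maps the ground set of `N` injectively into
the ground set of `M`, and it preserves and reflects independence. Equivalently, `φ` is an
isomorphism from `N` onto the restriction of `M` to the image of the ground set of `N`. -/
structure IsEmbedding {β α : Type*} (N : Matroid β) (M : Matroid α) (φ : β → α) : Prop where
  mapsTo : MapsTo φ N.E M.E
  injOn : InjOn φ N.E
  indep_iff : ∀ I ⊆ N.E, M.Indep (φ '' I) ↔ N.Indep I

/-- The simple matroid of rank at most three on a finite set in which the dependent sets with
at most three elements are exactly the members of `lines`; here `lines` is a family of triples,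
any two of which share at most one element. -/
def ofLines {β : Type*} [DecidableEq β] (lines : Finset (Finset β))
    (hcard : ∀ L ∈ lines, L.card = 3)
    (hinter : ∀ L ∈ lines, ∀ L' ∈ lines, L ≠ L' → (L ∩ L').card ≤ 1) : Matroid β :=
  (IndepMatroid.ofFinset (univ : Set β) (fun I => I.card ≤ 3 ∧ I ∉ lines)
    ⟨by simp, fun h => by simpa using hcard _ h⟩
    (by
      rintro I J ⟨hJ, hJl⟩ hIJ
      refine ⟨(Finset.card_le_card hIJ).trans hJ, fun hI => hJl ?_⟩
      rw [← Finset.eq_of_subset_of_card_le hIJ (by rw [hcard _ hI]; exact hJ)]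
      exact hI)
    (by
      rintro I J ⟨hI, hIl⟩ ⟨hJ, hJl⟩ hlt
      by_contra! hcon
      have key : ∀ e ∈ J, e ∉ I → insert e I ∈ lines := by
        intro e he heI
        have := hcon e he heI
        rw [Finset.card_insert_of_notMem heI] at this
        by_contra hn
        exact hn (this (by omega))
      have hne : ∃ e ∈ J, e ∉ I := by
        by_contra! h
        exact absurd (Finset.card_le_card (show J ⊆ I from h)) (by omega)
      obtain ⟨e, he, heI⟩ := hne
      have hIc : I.card = 2 := by
        have := hcard _ (key e he heI)
        rw [Finset.card_insert_of_notMem heI] at this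
        omega
      have hJc : J.card = 3 := by omega
      by_cases h2 : ∃ f ∈ J, f ∉ I ∧ f ≠ e
      · obtain ⟨f, hf, hfI, hfe⟩ := h2
        have hne : insert e I ≠ insert f I := fun h => by
          have : f ∈ insert e I := h ▸ Finset.mem_insert_self f I
          rcases Finset.mem_insert.1 this with h | h
          · exact hfe h
          · exact hfI h
        have h1 := hinter _ (key e he heI) _ (key f hf hfI) hne
        have h3 : I ⊆ insert e I ∩ insert f I :=
          Finset.subset_inter (Finset.subset_insert _ _) (Finset.subset_insert _ _)
        have := Finset.card_le_card h3
        omega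
      · push Not at h2
        have hsub : J ⊆ insert e I := fun f hf => by
          by_cases hfI : f ∈ I
          · exact Finset.mem_insert_of_mem hfI
          · rw [h2 f hf hfI]; exact Finset.mem_insert_self _ _
        refine hJl ?_
        rw [Finset.eq_of_subset_of_card_le hsub
          (by rw [Finset.card_insert_of_notMem heI]; omega)]
        exact key e he heI)
    (fun _ _ => subset_univ _)).matroid

/-- The three-point lines of the non-Fano matroid. The elements `0, 1, 2, 3, 4, 5, 6` stand for
`y, x, z, o, q, r, s`: the points `o, q, r, s` form a quadrangle with diagonal points
`y = oq ∩ rs` and `z = os ∩ qr`, the point `x` is the intersection of `yz` and `qs`. -/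
def nonFanoLines : Finset (Finset (Fin 7)) :=
  {{0, 1, 2}, {0, 3, 4}, {0, 5, 6}, {2, 3, 6}, {2, 4, 5}, {1, 4, 6}}

/-- The lines of the Fano matroid: those of the non-Fano matroid and `{x, o, r}`. -/
def fanoLines : Finset (Finset (Fin 7)) :=
  insert {1, 3, 5} nonFanoLines

set_option maxRecDepth 20000 in
/-- The non-Fano matroid `F₇⁻`, labelled. -/
def nonFano : Matroid (Fin 7) :=
  ofLines nonFanoLines (by decide) (by decide)

set_option maxRecDepth 20000 in
/-- The Fano matroid `F₇`, labelled. -/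
def fano : Matroid (Fin 7) :=
  ofLines fanoLines (by decide) (by decide)

section

variable {α : Type*} (M : Matroid α)

/-- `HP(y, x, z; o, q, r, s)`: the restriction of `M` to `{y, x, z, o, q, r, s}` is the Fano
matroid or the non-Fano matroid, labelled as above. -/
def HP (y x z o q r s : α) : Prop :=
  IsEmbedding fano M ![y, x, z, o, q, r, s] ∨ IsEmbedding nonFano M ![y, x, z, o, q, r, s]

/-- `H(y, z; x, x')`: the element `x'` is a harmonic conjugate of `x` with respect to
`y` and `z`. -/
def IsHarmonicConj (y z x x' : α) : Prop :=
  ∃ o q r s, HP M y x z o q r s ∧ M.closure {y, z} ∩ M.closure {o, r} = {x'}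

/-- A matroid is harmonic if every configuration `HP(y, x, z; o, q, r, s)` gives rise to a harmonic
conjugate of `x` with respect to `y` and `z`, and this conjugate depends only on `x, y, z`. -/
structure IsHarmonic : Prop where
  exists_conj : ∀ y x z o q r s, HP M y x z o q r s →
    ∃ x', M.closure {y, z} ∩ M.closure {o, r} = {x'}
  unique_conj : ∀ y z x x₁ x₂, IsHarmonicConj M y z x x₁ → IsHarmonicConj M y z x x₂ → x₁ = x₂

/-- One step of harmonic conjugation. -/
def harmonicStep (S : Set α) : Set α :=
  S ∪ {x | x ∈ M.E ∧ ∃ a ∈ S, ∃ b ∈ S, ∃ c ∈ S, IsHarmonicConj M a c b x}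

/-- The harmonic closure `h^∞(S)`. -/
def harmonicClosure (S : Set α) : Set α :=
  ⋃ n : ℕ, (harmonicStep M)^[n] S

end

section

variable (p : ℕ) [Fact p.Prime]

/-- The points of the projective plane over `ℤ / p`. -/
abbrev ProjPlane : Type :=
  Projectivization (ZMod p) (Fin 3 → ZMod p)

/-- The matroid `PG(2, p)`. -/
def PG2 : Matroid (ProjPlane p) :=
  (IndepMatroid.ofFinite (E := (univ : Set (ProjPlane p))) (Set.toFinite _)
    (fun I => Projectivization.Independent (fun P : I => (P : ProjPlane p)))
    (by
      rw [Projectivization.independent_iff]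
      exact linearIndependent_empty_type)
    (by
      intro I J hJ hIJ
      rw [Projectivization.independent_iff] at hJ ⊢
      exact LinearIndepOn.mono (v := Projectivization.rep) hJ hIJ)
    (by
      intro I J hI hJ hlt
      rw [Projectivization.independent_iff] at hI hJ
      change LinearIndepOn (ZMod p) Projectivization.rep I at hI
      change LinearIndepOn (ZMod p) Projectivization.rep J at hJ
      by_contra! hcon
      have hmem : ∀ e ∈ J, (Projectivization.rep e : Fin 3 → ZMod p) ∈
          Submodule.span (ZMod p) (Projectivization.rep '' I) := by
        intro e he
        by_cases heI : e ∈ I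
        · exact Submodule.subset_span (mem_image_of_mem _ heI)
        · by_contra hn
          refine hcon e he heI ?_
          rw [Projectivization.independent_iff]
          exact hI.insert hn
      have hle : Submodule.span (ZMod p) (Projectivization.rep '' J) ≤
          Submodule.span (ZMod p) (Projectivization.rep '' I) := by
        rw [Submodule.span_le]
        rintro _ ⟨e, he, rfl⟩
        exact hmem e he
      have h := Submodule.finrank_mono hle
      have hrank : ∀ K : Set (ProjPlane p), LinearIndepOn (ZMod p) Projectivization.rep K →
          Module.finrank (ZMod p) (Submodule.span (ZMod p) (Projectivization.rep '' K)) =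
            K.ncard := by
        intro K hK
        have : Fintype K := Fintype.ofFinite K
        have := finrank_span_eq_card (R := ZMod p) hK
        rw [Set.image_eq_range, this, ← Nat.card_eq_fintype_card, Nat.card_coe_set_eq]
      rw [hrank I hI, hrank J hJ] at h
      omega)
    (fun _ _ => subset_univ _)).matroid

variable {p}

/-- The point `[0, i, 1]`. -/
def ptA (i : ZMod p) : ProjPlane p :=
  Projectivization.mk (ZMod p) ![0, i, 1] (fun h => by simpa using congrFun h 2)

/-- The point `[1, i, 1]`. -/
def ptB (i : ZMod p) : ProjPlane p :=
  Projectivization.mk (ZMod p) ![1, i, 1] (fun h => by simpa using congrFun h 2)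

/-- The point `[1, i, 0]`. -/
def ptC (i : ZMod p) : ProjPlane p :=
  Projectivization.mk (ZMod p) ![1, i, 0] (fun h => by simpa using congrFun h 0)

variable (p)

/-- The point `[0, 1, 0]`. -/
def ptD : ProjPlane p :=
  Projectivization.mk (ZMod p) ![0, 1, 0] (fun h => by simpa using congrFun h 1)

/-- The matroid `L_p`: the restriction of `PG(2, p)` to the three concurrent lines
`{[0, i, 1]} ∪ {[0, 1, 0]}`, `{[1, i, 1]} ∪ {[0, 1, 0]}` and `{[1, i, 0]} ∪ {[0, 1, 0]}`. -/
def Lp : Matroid (ProjPlane p) :=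
  (PG2 p).restrict (range ptA ∪ range ptB ∪ range ptC ∪ {ptD p})

variable {p}

/-- The line `⟨j, -1, i⟩_p` of `L_p`, which consists of the points `[x, y, z]` of `L_p` with
`j x - y + i z = 0`. -/
def lineLp (j i : ZMod p) : Set (ProjPlane p) :=
  {ptA i, ptB (i + j), ptC j}

end

end HarmonicMatroid

/-! The idea is to coordinatize the plane spanned by `L_p` inside `M`. An element represents a
vector when it lies on exactly the spans of pairs `A i`, `C j` that the vector prescribes. Elements
outside the plane also avoid all these spans, so only `D` is allowed to represent multiples of [0,
1, 0]. Lines through `D` are not such spans. They are handled as directions (e₀, e₂), good when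
every [e₀, η, e₂] is represented and all representatives are collinear with `D`. `L_p` supplies the
good directions (0, 1), (1, 1), (1, 0).

Uniqueness of harmonic conjugates creates new good directions. In `Frame.conc_sub` one conjugate,
computed from many quadrangles containing `D`, is forced onto every line through y - z. In
`Frame.aligned` a conjugate already known to be `D` forces a new line to pass through `D`. Since ℤ_p
is generated by 1, induction reaches every direction; for p = 2 the given ones suffice.

Then every nonzero vector is represented, y - z is conjugate to y + z (`Plane.isHarmonicConj`),
representatives are unique, and conjugates of represented elements are represented. So the harmonic
closure of `L_p` consists of representatives, and those on the line (j, i) are reached from `C j`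
and `B (i + j)` by repeated conjugation with `A i` (`Plane.mem_harmonicClosure`). The other
inclusion is formal. If `M` has a loop, it is the only possible conjugate, and this case is settled
separately. -/

namespace HarmonicMatroid

/-! ### Rank and exchange on the spans of two points -/

section Lines

variable {K α : Type*} {M : Matroid α} {A C : K → α}

/-- The span in `M` of the points `A i = [0, i, 1]` and `C j = [1, j, 0]`. -/
def line (M : Matroid α) (A C : K → α) (j i : K) : Set α := M.closure {A i, C j}

theorem mem_closure_singleton_of_mem_pair {a b c : α} (h : c ∈ M.closure {a, b})
    (hb : b ∉ M.closure {a, c}) : c ∈ M.closure {a} := by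
  by_contra hc
  have := (Matroid.closure_exchange (M := M) (X := {a}) (e := c) (f := b)
    ⟨by rwa [pair_comm], hc⟩).1
  rw [pair_comm] at this
  exact hb this

theorem closure_pair_subset_line {a b : α} {j i : K} (ha : a ∈ line M A C j i)
    (hb : b ∈ line M A C j i) : M.closure {a, b} ⊆ line M A C j i :=
  M.closure_subset_closure_of_subset_closure (by rintro x (rfl | rfl) <;> assumption)

theorem closure_singleton_subset_line {a : α} {j i : K} (ha : a ∈ line M A C j i) :
    M.closure {a} ⊆ line M A C j i :=
  M.closure_subset_closure_of_subset_closure (by rintro x rfl; assumption)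

theorem eRk_line_le (j i : K) : M.eRk (line M A C j i) ≤ 2 := by
  rw [line, M.eRk_closure_eq]
  exact (M.eRk_le_encard _).trans
    (encard_insert_le _ _ |>.trans (by rw [encard_singleton]; norm_num))

theorem indep_pair_of_notMem {a b : α} (ha : M.IsNonloop a) (hb : b ∈ M.E)
    (h : b ∉ M.closure {a}) : M.Indep {a, b} := by
  rw [pair_comm]
  exact ((Matroid.indep_singleton.2 ha).notMem_closure_iff hb).1 h |>.1

theorem line_subset_closure_pair {a b : α} {j i : K} (ha : a ∈ line M A C j i)
    (hb : b ∈ line M A C j i) (hab : M.Indep {a, b}) (hne : a ≠ b) :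
    line M A C j i ⊆ M.closure {a, b} := by
  have hfin : M.IsRkFinite {A i, C j} := M.isRkFinite_of_finite (toFinite _)
  have := (M.isRkFinite_of_finite (toFinite {a, b})).closure_eq_closure_of_subset_of_eRk_ge_eRk
    (M := M) (X := {a, b}) (Y := line M A C j i) (by rintro x (rfl | rfl) <;> assumption)
    (by rw [hab.eRk_eq_encard, encard_pair hne]; exact eRk_line_le j i)
  rw [this, line, M.closure_closure]

end Lines

/-! ### Representatives of vectors and their incidences -/

section Frame

variable {K α : Type*} [Field K] {M : Matroid α} {A C : K → α} {D : α}

/-- The element `a` has the same incidences with the lines `j x - y + i z = 0` as the point with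
coordinate vector `v`; only `D` represents the point `[0, 1, 0]`. -/
structure Rep (M : Matroid α) (A C : K → α) (D : α) (v : Fin 3 → K) (a : α) : Prop where
  ne_zero : v ≠ 0
  mem_ground : a ∈ M.E
  mem_line_iff : ∀ j i, a ∈ line M A C j i ↔ j * v 0 + i * v 2 = v 1
  eq_of_eq_zero : v 0 = 0 → v 2 = 0 → a = D

/-- Elements `A i`, `C j`, `D` in the position of the points `[0, i, 1]`, `[1, j, 0]`,
`[0, 1, 0]` of a projective plane. -/
structure Frame (M : Matroid α) (A C : K → α) (D : α) : Prop where
  repA : ∀ i, Rep M A C D ![0, i, 1] (A i)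
  repC : ∀ j, Rep M A C D ![1, j, 0] (C j)
  repD : Rep M A C D ![0, 1, 0] D
  planeA : ∀ i, A i ∈ M.closure {A 0, D}
  planeC : ∀ j, C j ∈ M.closure {C 0, D}

/-- The determinant of the matrix with rows `u, v, w`. -/
def det3 (u v w : Fin 3 → K) : K :=
  u 0 * (v 1 * w 2 - v 2 * w 1) - u 1 * (v 0 * w 2 - v 2 * w 0) + u 2 * (v 0 * w 1 - v 1 * w 0)

theorem exists_line_params {u v : Fin 3 → K} (h : u 0 * v 2 - u 2 * v 0 ≠ 0) (r s : K) :
    ∃ j i : K, j * u 0 + i * u 2 = r ∧ j * v 0 + i * v 2 = s := by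
  refine ⟨(r * v 2 - s * u 2) / (u 0 * v 2 - u 2 * v 0),
    (s * u 0 - r * v 0) / (u 0 * v 2 - u 2 * v 0), ?_, ?_⟩ <;>
    rw [div_mul_eq_mul_div, div_mul_eq_mul_div, ← add_div, div_eq_iff h] <;> ring

namespace Rep

variable {u v w : Fin 3 → K} {a b c : α}

theorem smul (h : Rep M A C D v a) {k : K} (hk : k ≠ 0) : Rep M A C D (k • v) a where
  ne_zero := smul_ne_zero hk h.ne_zero
  mem_ground := h.mem_ground
  mem_line_iff j i := by
    rw [h.mem_line_iff]
    simp only [Pi.smul_apply, smul_eq_mul]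
    constructor
    · intro e; linear_combination k * e
    · intro e; exact mul_left_cancel₀ hk (by linear_combination e)
  eq_of_eq_zero h0 h2 := h.eq_of_eq_zero (by simpa [hk] using h0) (by simpa [hk] using h2)

theorem exists_notMem_line (h : Rep M A C D v a) : ∃ j i, a ∉ line M A C j i := by
  by_contra! hall
  simp only [h.mem_line_iff] at hall
  have h0 : 0 * v 0 + 0 * v 2 = v 1 := hall 0 0
  have h1 := hall 1 0
  have h2 := hall 0 1
  apply h.ne_zero
  have e0 : v 0 = 0 := by linear_combination h1 - h0
  have e2 : v 2 = 0 := by linear_combination h2 - h0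
  have e1 : v 1 = 0 := by linear_combination -h0
  ext k
  fin_cases k <;> assumption

theorem isNonloop (h : Rep M A C D v a) : M.IsNonloop a := by
  rw [Matroid.isNonloop_iff, Matroid.isLoop_iff]
  refine ⟨fun hl => ?_, h.mem_ground⟩
  obtain ⟨j, i, hji⟩ := h.exists_notMem_line
  exact hji (M.closure_subset_closure (empty_subset _) hl)

theorem notMem_closure_singleton (hu : Rep M A C D u a) (hv : Rep M A C D v b)
    (h : u 0 * v 2 - u 2 * v 0 ≠ 0) : b ∉ M.closure {a} := by
  obtain ⟨j, i, h1, h2⟩ := exists_line_params h (u 1) (v 1 + 1)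
  intro hb
  have := closure_singleton_subset_line ((hu.mem_line_iff j i).2 h1) hb
  rw [hv.mem_line_iff, h2] at this
  simp at this

theorem notMem_closure_pair_of_ne_zero (hu : Rep M A C D u a) (hv : Rep M A C D v b)
    (hw : Rep M A C D w c) (h : det3 u v w ≠ 0) (huv : u 0 * v 2 - u 2 * v 0 ≠ 0) :
    c ∉ M.closure {a, b} := by
  obtain ⟨j, i, h1, h2⟩ := exists_line_params huv (u 1) (v 1)
  intro hc
  have := closure_pair_subset_line ((hu.mem_line_iff j i).2 h1) ((hv.mem_line_iff j i).2 h2) hc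
  rw [hw.mem_line_iff] at this
  apply h
  unfold det3
  rw [← this, ← h1, ← h2]
  ring

/-- A pair with zero minor need not lie on a line j x - y + i z = 0. Exchange then passes to another
pair; a nonzero determinant leaves some minor nonzero. -/
theorem notMem_closure_pair (hu : Rep M A C D u a) (hv : Rep M A C D v b)
    (hw : Rep M A C D w c) (h : det3 u v w ≠ 0) : c ∉ M.closure {a, b} := by
  by_cases huv : u 0 * v 2 - u 2 * v 0 = 0
  swap
  · exact notMem_closure_pair_of_ne_zero hu hv hw h huv
  intro hc
  by_cases huw : u 0 * w 2 - u 2 * w 0 = 0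
  · by_cases hvw : v 0 * w 2 - v 2 * w 0 = 0
    · apply h
      unfold det3
      linear_combination v 1 * huw - w 1 * huv - u 1 * hvw
    · rw [pair_comm] at hc
      refine notMem_closure_singleton hv hw hvw (mem_closure_singleton_of_mem_pair hc ?_)
      refine notMem_closure_pair_of_ne_zero hv hw hu (fun h' => h ?_) hvw
      rw [← h']; unfold det3; ring
  · refine notMem_closure_singleton hu hw huw (mem_closure_singleton_of_mem_pair hc ?_)
    refine notMem_closure_pair_of_ne_zero hu hw hv (fun h' => h ?_) huw
    rw [← neg_eq_zero, ← h']; unfold det3; ring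

theorem indep_triple (hu : Rep M A C D u a) (hv : Rep M A C D v b)
    (hw : Rep M A C D w c) (h : det3 u v w ≠ 0) : M.Indep {a, b, c} := by
  have hc := notMem_closure_pair hu hv hw h
  have hb : b ∉ M.closure {a, c} := notMem_closure_pair hu hw hv (fun h' => h (by
    rw [← neg_eq_zero, ← h']; unfold det3; ring))
  have hab := indep_pair_of_notMem hu.isNonloop hv.mem_ground
    (fun hb' => hb (M.closure_subset_closure (by simp) hb'))
  have := (hab.notMem_closure_iff hw.mem_ground).1 hc |>.1
  rwa [insert_comm, pair_comm c b, insert_comm, insert_comm] at this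

/-- The nonzero minor says that the join of `u` and `v` misses [0, 1, 0], so it is a line with
parameters (j, i). -/
theorem eRk_triple_le (hu : Rep M A C D u a) (hv : Rep M A C D v b)
    (hw : Rep M A C D w c) (h : det3 u v w = 0) (huv : u 0 * v 2 - u 2 * v 0 ≠ 0) :
    M.eRk {a, b, c} ≤ 2 := by
  obtain ⟨j, i, h1, h2⟩ := exists_line_params huv (u 1) (v 1)
  refine (M.eRk_mono ?_).trans (eRk_line_le (A := A) (C := C) j i)
  rintro x (rfl | rfl | rfl)
  · exact (hu.mem_line_iff j i).2 h1
  · exact (hv.mem_line_iff j i).2 h2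
  · refine (hw.mem_line_iff j i).2 (mul_left_cancel₀ huv ?_)
    unfold det3 at h
    linear_combination h + (u 0 * w 2 - u 2 * w 0) * h2 - (v 0 * w 2 - v 2 * w 0) * h1

end Rep

namespace Frame

variable {v : Fin 3 → K} {a b : α}

/-- If `a`, `b` were independent, the first line would lie inside the second; its points `A i` and
`C j` would then force equal parameters. -/
theorem mem_closure_of_mem_lines (hF : Frame M A C D) {j i j' i' : K} (hne : j ≠ j' ∨ i ≠ i')
    (haE : M.IsNonloop a) (ha : a ∈ line M A C j i) (ha' : a ∈ line M A C j' i')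
    (hb : b ∈ line M A C j i) (hb' : b ∈ line M A C j' i') : b ∈ M.closure {a} := by
  by_contra h
  have hbE : b ∈ M.E := M.closure_subset_ground _ hb
  have hi := indep_pair_of_notMem haE hbE h
  have hab : a ≠ b := by
    rintro rfl
    exact h (M.mem_closure_of_mem' (mem_singleton _) hbE)
  have hsub := (line_subset_closure_pair ha hb hi hab).trans (closure_pair_subset_line ha' hb')
  have h1 := ((hF.repA i).mem_line_iff j' i').1 (hsub (((hF.repA i).mem_line_iff j i).2 (by simp)))
  have h2 := ((hF.repC j).mem_line_iff j' i').1 (hsub (((hF.repC j).mem_line_iff j i).2 (by simp)))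
  simp at h1 h2
  rcases hne with h | h
  · exact h h2.symm
  · exact h h1.symm

theorem mem_closure_of_rep (hF : Frame M A C D) (ha : Rep M A C D v a) (hb : Rep M A C D v b) :
    b ∈ M.closure {a} := by
  have aux : ∀ j i j' i', (j ≠ j' ∨ i ≠ i') → j * v 0 + i * v 2 = v 1 →
      j' * v 0 + i' * v 2 = v 1 → b ∈ M.closure {a} := fun j i j' i' hne h h' =>
    hF.mem_closure_of_mem_lines hne ha.isNonloop ((ha.mem_line_iff _ _).2 h)
      ((ha.mem_line_iff _ _).2 h') ((hb.mem_line_iff _ _).2 h) ((hb.mem_line_iff _ _).2 h')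
  by_cases h0 : v 0 = 0
  · by_cases h2 : v 2 = 0
    · rw [ha.eq_of_eq_zero h0 h2, hb.eq_of_eq_zero h0 h2]
      exact M.mem_closure_of_mem' (mem_singleton _) hF.repD.mem_ground
    · exact aux 0 (v 1 / v 2) 1 (v 1 / v 2) (by simp) (by field_simp; simp)
        (by rw [h0]; field_simp; simp)
  · refine aux (v 1 / v 0) 0 ((v 1 - v 2) / v 0) 1 (by simp) (by field_simp; simp)
      (by field_simp; ring)

/-- A further line through `a` shares some `C j` or `A i` with a line through `v`. That point would
be parallel to `a`, hence on every line through `v`, which its coordinates exclude. -/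
theorem rep_of_mem_line (hF : Frame M A C D) (ha : M.IsNonloop a) (hv : ¬ (v 0 = 0 ∧ v 2 = 0))
    (h : ∀ j i, j * v 0 + i * v 2 = v 1 → a ∈ line M A C j i) : Rep M A C D v a where
  ne_zero := by rintro rfl; simp at hv
  mem_ground := ha.mem_ground
  eq_of_eq_zero h0 h2 := absurd ⟨h0, h2⟩ hv
  mem_line_iff j i := by
    refine ⟨fun hji => ?_, h j i⟩
    by_contra hne
    by_cases h0 : v 0 = 0
    · have h2 : v 2 ≠ 0 := fun h2 => hv ⟨h0, h2⟩
      have h3 : j * v 0 + (v 1 / v 2) * v 2 = v 1 := by rw [h0]; field_simp; simp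
      have h4 : (j + 1) * v 0 + (v 1 / v 2) * v 2 = v 1 := by rw [h0]; field_simp; simp
      have hC := hF.mem_closure_of_mem_lines (b := C j) (j := j) (i := i) (j' := j)
        (i' := v 1 / v 2) (Or.inr (by rintro rfl; exact hne h3)) ha hji (h _ _ h3)
        (((hF.repC j).mem_line_iff _ _).2 (by simp)) (((hF.repC j).mem_line_iff _ _).2 (by simp))
      have := closure_singleton_subset_line (h _ _ h4) hC
      rw [(hF.repC j).mem_line_iff] at this
      simp at this
    · have h3 : ((v 1 - i * v 2) / v 0) * v 0 + i * v 2 = v 1 := by field_simp; ring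
      have h4 : ((v 1 - (i + 1) * v 2) / v 0) * v 0 + (i + 1) * v 2 = v 1 := by field_simp; ring
      have hA := hF.mem_closure_of_mem_lines (b := A i) (j := j) (i := i)
        (j' := (v 1 - i * v 2) / v 0)
        (i' := i) (Or.inl (by intro e; rw [← e] at h3; exact hne h3)) ha hji (h _ _ h3)
        (((hF.repA i).mem_line_iff _ _).2 (by simp)) (((hF.repA i).mem_line_iff _ _).2 (by simp))
      have := closure_singleton_subset_line (h _ _ h4) hA
      rw [(hF.repA i).mem_line_iff] at this
      simp at this

theorem mem_plane (hF : Frame M A C D) (ha : Rep M A C D v a) :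
    a ∈ M.closure {A 0, C 0, D} := by
  have hD : D ∈ M.closure {A 0, C 0, D} := M.mem_closure_of_mem' (by simp) hF.repD.mem_ground
  have hA : ∀ i, A i ∈ M.closure {A 0, C 0, D} := fun i =>
    M.closure_subset_closure (by rintro x (rfl | rfl) <;> simp) (hF.planeA i)
  have hC : ∀ j, C j ∈ M.closure {A 0, C 0, D} := fun i =>
    M.closure_subset_closure (by rintro x (rfl | rfl) <;> simp) (hF.planeC i)
  have aux : ∀ j i, j * v 0 + i * v 2 = v 1 → a ∈ M.closure {A 0, C 0, D} := fun j i h =>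
    M.closure_subset_closure_of_subset_closure
      (by rintro x (rfl | rfl); exacts [hA i, hC j]) ((ha.mem_line_iff j i).2 h)
  by_cases h0 : v 0 = 0
  · by_cases h2 : v 2 = 0
    · rwa [ha.eq_of_eq_zero h0 h2]
    · exact aux 0 (v 1 / v 2) (by field_simp; simp)
  · exact aux (v 1 / v 0) 0 (by field_simp; simp)

end Frame
end Frame

/-! ### Recognizing Fano and non-Fano configurations from coordinates -/

section Template

set_option maxRecDepth 20000

/-- Coordinates of the seven points of the labelled Fano and non-Fano matroids. -/
def coef : Fin 7 → Fin 3 → ℤ :=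
  ![![1, 0, 0], ![1, 1, 0], ![0, 1, 0], ![1, 0, 1], ![0, 0, 1], ![0, 1, 1], ![1, 1, 1]]

/-- The determinant of three of the coordinate vectors `coef`. -/
def coefDet (a b c : Fin 7) : ℤ :=
  coef a 0 * (coef b 1 * coef c 2 - coef b 2 * coef c 1) -
  coef a 1 * (coef b 0 * coef c 2 - coef b 2 * coef c 0) +
  coef a 2 * (coef b 0 * coef c 1 - coef b 1 * coef c 0)

/-- Minors ±1 stay nonzero in every characteristic. The triple x, o, r, with determinant ±2, is
excluded by using `fanoLines`. -/
theorem coefDet_eq : ∀ a b c : Fin 7, a ≠ b → a ≠ c → b ≠ c → {a, b, c} ∉ fanoLines →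
    coefDet a b c = 1 ∨ coefDet a b c = -1 := by
  decide +kernel

theorem exists_notMem_fanoLines : ∀ a b : Fin 7, ∃ c d : Fin 7,
    a ≠ c ∧ a ≠ d ∧ c ≠ d ∧ (b = a ∨ b = c) ∧ {a, c, d} ∉ fanoLines := by
  decide +kernel

theorem exists_pair_notMem_fanoLines : ∀ a b : Fin 7, a ≠ b → ∃ c : Fin 7,
    a ≠ c ∧ b ≠ c ∧ {a, b, c} ∉ fanoLines := by
  decide +kernel

variable {K α : Type*} [Field K] {M : Matroid α} {A C : K → α} {D : α}

/-- The vectors representing `y, x, z, o, q, r, s` when `u, v, w` represent `y, z, q`. -/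
def template (u v w : Fin 3 → K) : Fin 7 → Fin 3 → K :=
  ![u, u + v, v, u + w, w, v + w, u + v + w]

theorem template_apply (u v w : Fin 3 → K) (k : Fin 7) (i : Fin 3) :
    template u v w k i = coef k 0 * u i + coef k 1 * v i + coef k 2 * w i := by
  fin_cases k <;> simp [template, coef]

theorem det3_template (u v w : Fin 3 → K) (a b c : Fin 7) :
    det3 (template u v w a) (template u v w b) (template u v w c) =
      coefDet a b c * det3 u v w := by
  simp only [det3, template_apply, coefDet]
  push_cast
  ring

theorem ofLines_indep {β : Type*} [DecidableEq β] (lines : Finset (Finset β)) (hcard) (hinter)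
    (s : Finset β) : (ofLines lines hcard hinter).Indep s ↔ s.card ≤ 3 ∧ s ∉ lines := by
  simp [ofLines]

theorem isEmbedding_ofLines {β : Type*} [Fintype β] [DecidableEq β] {lines : Finset (Finset β)}
    {hcard hinter} {f : β → α} (hE : ∀ k, f k ∈ M.E) (hf : Function.Injective f)
    (hr : M.eRk (range f) ≤ 3) (hpair : ∀ s : Finset β, s.card ≤ 2 → M.Indep (f '' s))
    (h : ∀ s : Finset β, s.card = 3 → (M.Indep (f '' s) ↔ s ∉ lines)) :
    IsEmbedding (ofLines lines hcard hinter) M f where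
  mapsTo k _ := hE k
  injOn := hf.injOn
  indep_iff I _ := by
    classical
    obtain ⟨s, rfl⟩ : ∃ s : Finset β, (s : Set β) = I := ⟨I.toFinset, by simp⟩
    rw [ofLines_indep]
    rcases lt_trichotomy s.card 3 with hs | hs | hs
    · exact ⟨fun _ => ⟨hs.le, fun hl => by have := hcard _ hl; omega⟩,
        fun _ => hpair s (by omega)⟩
    · rw [h s hs]
      exact ⟨fun hn => ⟨hs.le, hn⟩, And.right⟩
    · refine ⟨fun hi => ?_, fun hi => by omega⟩
      have h1 := (hi.encard_le_eRk_of_subset (image_subset_range f s)).trans hr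
      rw [hf.injOn.encard_image, encard_coe_eq_coe_finsetCard] at h1
      exact absurd (by exact_mod_cast h1 : s.card ≤ 3) (by omega)

theorem Frame.isEmbedding_template (hF : Frame M A C D) {u v w : Fin 3 → K}
    (hdet : det3 u v w ≠ 0) {f : Fin 7 → α} (hf : ∀ k, Rep M A C D (template u v w k) (f k))
    (hcol : ∀ L ∈ nonFanoLines, M.eRk (f '' L) ≤ 2) :
    IsEmbedding fano M f ∨ IsEmbedding nonFano M f := by
  have hne : ∀ a b c : Fin 7, a ≠ b → a ≠ c → b ≠ c → {a, b, c} ∉ fanoLines →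
      det3 (template u v w a) (template u v w b) (template u v w c) ≠ 0 := by
    intro a b c hab hac hbc hl
    rw [det3_template]
    rcases coefDet_eq a b c hab hac hbc hl with h | h <;> simp [h, hdet]
  have htri : ∀ a b c : Fin 7, a ≠ b → a ≠ c → b ≠ c → {a, b, c} ∉ fanoLines →
      M.Indep {f a, f b, f c} := fun a b c hab hac hbc hl =>
    (hf a).indep_triple (hf b) (hf c) (hne a b c hab hac hbc hl)
  have hinj : Function.Injective f := by
    intro a b hab
    by_contra h
    obtain ⟨c, hac, hbc, hl⟩ := exists_pair_notMem_fanoLines a b h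
    have hl' : {c, a, b} ∉ fanoLines := by
      rwa [Finset.insert_comm, Finset.pair_comm c b]
    refine (hf c).notMem_closure_pair (hf a) (hf b) (hne c a b hac.symm hbc.symm h hl') ?_
    exact M.mem_closure_of_mem' (by simp [hab]) (hf b).mem_ground
  have hr : M.eRk (range f) ≤ 3 := by
    have hsub : range f ⊆ M.closure {A 0, C 0, D} := by
      rintro _ ⟨k, rfl⟩
      exact hF.mem_plane (hf k)
    refine (M.eRk_mono hsub).trans ?_
    rw [M.eRk_closure_eq]
    refine (M.eRk_le_encard _).trans ((encard_insert_le _ _).trans ?_)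
    refine (add_le_add_left (encard_insert_le _ _) 1).trans ?_
    rw [encard_singleton]
    norm_num
  have hpair : ∀ s : Finset (Fin 7), s.card ≤ 2 → M.Indep (f '' s) := by
    intro s hs
    obtain ⟨a, b, hab⟩ : ∃ a b : Fin 7, s ⊆ {a, b} := by
      interval_cases h : s.card
      · exact ⟨0, 0, by simp [Finset.card_eq_zero.1 h]⟩
      · obtain ⟨a, rfl⟩ := Finset.card_eq_one.1 h
        exact ⟨a, a, by simp⟩
      · obtain ⟨a, b, -, rfl⟩ := Finset.card_eq_two.1 h
        exact ⟨a, b, subset_rfl⟩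
    obtain ⟨c, d, hac, had, hcd, hb, hl⟩ := exists_notMem_fanoLines a b
    refine (htri a c d hac had hcd hl).subset ?_
    rintro _ ⟨k, hk, rfl⟩
    have := hab hk
    rw [Finset.mem_insert, Finset.mem_singleton] at this
    rcases hb with rfl | rfl <;> rcases this with rfl | rfl <;> simp
  have hdep : ∀ s : Finset (Fin 7), s.card = 3 → s ∈ nonFanoLines → ¬ M.Indep (f '' s) := by
    intro s hs hl hi
    have h1 := hcol s hl
    rw [hi.eRk_eq_encard, hinj.injOn.encard_image, encard_coe_eq_coe_finsetCard, hs] at h1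
    exact absurd h1 (by decide)
  have hind : ∀ s : Finset (Fin 7), s.card = 3 → s ∉ fanoLines → M.Indep (f '' s) := by
    intro s hs hl
    obtain ⟨a, b, c, hab, hac, hbc, rfl⟩ := Finset.card_eq_three.1 hs
    have := htri a b c hab hac hbc hl
    simpa [image_insert_eq] using this
  have hE : ∀ k, f k ∈ M.E := fun k => (hf k).mem_ground
  -- Only the triple x, o, r is still undecided; its independence in `M` separates the two
  -- configurations.
  by_cases hx : M.Indep (f '' (({1, 3, 5} : Finset (Fin 7)) : Set (Fin 7)))
  · refine Or.inr (isEmbedding_ofLines hE hinj hr hpair fun s hs => ?_)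
    refine ⟨fun hi hl => hdep s hs hl hi, fun hl => ?_⟩
    by_cases h : s = {1, 3, 5}
    · rwa [h]
    · exact hind s hs (by simp [fanoLines, h, hl])
  · refine Or.inl (isEmbedding_ofLines hE hinj hr hpair fun s hs => ?_)
    refine ⟨fun hi hl => ?_, hind s hs⟩
    rcases Finset.mem_insert.1 hl with rfl | hl
    · exact hx hi
    · exact hdep s hs hl hi

/-- Representatives of `a`, `b` and `a + b` are collinear. -/
def ColPair (M : Matroid α) (A C : K → α) (D : α) (a b : Fin 3 → K) : Prop :=
  ∀ x y z, Rep M A C D a x → Rep M A C D b y → Rep M A C D (a + b) z → M.eRk {x, y, z} ≤ 2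

theorem colPair_of_ne_zero {a b : Fin 3 → K} (h : a 0 * b 2 - a 2 * b 0 ≠ 0) :
    ColPair M A C D a b := fun _ _ _ hx hy hz =>
  hx.eRk_triple_le hy hz (by simp only [det3, Pi.add_apply]; ring) h

theorem Frame.hp (hF : Frame M A C D) {u v w : Fin 3 → K} (hdet : det3 u v w ≠ 0)
    {y x z o q r s : α} (hy : Rep M A C D u y) (hx : Rep M A C D (u + v) x)
    (hz : Rep M A C D v z) (ho : Rep M A C D (u + w) o) (hq : Rep M A C D w q)
    (hr : Rep M A C D (v + w) r) (hs : Rep M A C D (u + v + w) s)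
    (h1 : ColPair M A C D u v) (h2 : ColPair M A C D u w) (h3 : ColPair M A C D v w)
    (h4 : ColPair M A C D u (v + w)) (h5 : ColPair M A C D v (u + w))
    (h6 : ColPair M A C D (u + v) w) : HP M y x z o q r s := by
  refine hF.isEmbedding_template hdet (f := ![y, x, z, o, q, r, s]) ?_ ?_
  · intro k
    fin_cases k <;> assumption
  · have c1 := h1 _ _ _ hy hz hx
    have c2 := h2 _ _ _ hy hq ho
    have c3 := h3 _ _ _ hz hq hr
    have c4 := h4 _ _ _ hy hr (by rwa [← add_assoc])
    have c5 := h5 _ _ _ hz ho (by rwa [add_left_comm, ← add_assoc])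
    have c6 := h6 _ _ _ hx hq hs
    intro L hL
    simp only [nonFanoLines, Finset.mem_insert, Finset.mem_singleton] at hL
    rcases hL with rfl | rfl | rfl | rfl | rfl | rfl
    · simpa [image_insert_eq, pair_comm x z] using c1
    · simpa [image_insert_eq, pair_comm o q] using c2
    · simpa [image_insert_eq] using c4
    · simpa [image_insert_eq] using c5
    · simpa [image_insert_eq] using c3
    · simpa [image_insert_eq] using c6

end Template

/-! ### Producing good directions from harmonic conjugates -/

section Directions

variable {K α : Type*} [Field K] {M : Matroid α} {A C : K → α} {D : α}

/-- Every point `[e₀, η, e₂]` has a representative. -/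
def Conc (M : Matroid α) (A C : K → α) (D : α) (e₀ e₂ : K) : Prop :=
  ∀ η, ∃ x, Rep M A C D ![e₀, η, e₂] x

/-- The representatives of the points `[e₀, η, e₂]` are collinear with `D`. -/
def Aligned (M : Matroid α) (A C : K → α) (D : α) (e₀ e₂ : K) : Prop :=
  ∀ a b x y, Rep M A C D a x → Rep M A C D b y → a 0 * e₂ = a 2 * e₀ → b 0 * e₂ = b 2 * e₀ →
    ¬ (a 0 = 0 ∧ a 2 = 0) → y ∈ M.closure {x, D}

/-- The element `D` is a harmonic conjugate of `[f₀, (η + η') / 2, f₂]` with respect to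
`[f₀, η, f₂]` and `[f₀, η', f₂]`. -/
def FixConj (M : Matroid α) (A C : K → α) (D : α) (f₀ f₂ : K) : Prop :=
  ∀ η η' y z x, η ≠ η' → Rep M A C D ![f₀, η, f₂] y → Rep M A C D ![f₀, η', f₂] z →
    Rep M A C D ![f₀ + f₀, η + η', f₂ + f₂] x → IsHarmonicConj M y z x D

theorem Conc.exists_rep {e₀ e₂ : K} (h : Conc M A C D e₀ e₂) (v : Fin 3 → K) (h0 : v 0 = e₀)
    (h2 : v 2 = e₂) : ∃ x, Rep M A C D v x := by
  have : v = ![e₀, v 1, e₂] := by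
    ext k
    fin_cases k <;> simp [h0, h2]
  rw [this]
  exact h _

theorem Conc.smul {e₀ e₂ c : K} (h : Conc M A C D e₀ e₂) (hc : c ≠ 0) :
    Conc M A C D (c * e₀) (c * e₂) := by
  intro η
  obtain ⟨x, hx⟩ := h (η / c)
  refine ⟨x, ?_⟩
  have := hx.smul hc
  simpa [mul_div_cancel₀ _ hc] using this

theorem Aligned.smul {e₀ e₂ c : K} (h : Aligned M A C D e₀ e₂) (hc : c ≠ 0) :
    Aligned M A C D (c * e₀) (c * e₂) := fun a b x y hx hy ha hb hne =>
  h a b x y hx hy (mul_left_cancel₀ hc (by linear_combination ha))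
    (mul_left_cancel₀ hc (by linear_combination hb)) hne

theorem Aligned.colPair {e₀ e₂ : K} {a b : Fin 3 → K} (h : Aligned M A C D e₀ e₂)
    (ha : a 0 * e₂ = a 2 * e₀) (hb : b 0 * e₂ = b 2 * e₀) (hne : ¬ (a 0 = 0 ∧ a 2 = 0)) :
    ColPair M A C D a b := by
  intro x y z hx hy hz
  have hsub : ({x, y, z} : Set α) ⊆ M.closure {x, D} := by
    rintro t (rfl | rfl | rfl)
    · exact h _ _ _ _ hx hx ha ha hne
    · exact h _ _ _ _ hx hy ha hb hne
    · refine h _ _ _ _ hx hz ha ?_ hne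
      simp only [Pi.add_apply]
      linear_combination ha + hb
  refine (M.eRk_mono hsub).trans ?_
  rw [M.eRk_closure_eq]
  exact (M.eRk_le_encard _).trans
    (encard_insert_le _ _ |>.trans (by rw [encard_singleton]; norm_num))

theorem ColPair.symm {a b : Fin 3 → K} (h : ColPair M A C D a b) : ColPair M A C D b a := by
  intro x y z hx hy hz
  rw [insert_comm]
  exact h y x z hy hx (by rwa [add_comm])

theorem Rep.exists_line {v : Fin 3 → K} {a : α} (h : Rep M A C D v a)
    (hne : ¬ (v 0 = 0 ∧ v 2 = 0)) : ∃ j i, j * v 0 + i * v 2 = v 1 ∧ a ∈ line M A C j i := by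
  have : ∃ j i, j * v 0 + i * v 2 = v 1 := by
    by_cases h0 : v 0 = 0
    · have h2 : v 2 ≠ 0 := fun h2 => hne ⟨h0, h2⟩
      exact ⟨0, v 1 / v 2, by field_simp; simp⟩
    · exact ⟨v 1 / v 0, 0, by field_simp; simp⟩
  obtain ⟨j, i, hji⟩ := this
  exact ⟨j, i, hji, (h.mem_line_iff j i).2 hji⟩

theorem Frame.notMem_line (hF : Frame M A C D) (j i : K) : D ∉ line M A C j i := by
  rw [hF.repD.mem_line_iff]
  simp

theorem Frame.notMem_closure_singleton (hF : Frame M A C D) {v : Fin 3 → K} {a : α}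
    (h : Rep M A C D v a) (hne : ¬ (v 0 = 0 ∧ v 2 = 0)) : D ∉ M.closure {a} := by
  obtain ⟨j, i, -, hji⟩ := h.exists_line hne
  exact fun hD => hF.notMem_line j i (closure_singleton_subset_line hji hD)

theorem Rep.notMem_closure_singleton_of_ne {e₀ e₂ η η' : K} {x y : α} (he : ¬ (e₀ = 0 ∧ e₂ = 0))
    (hη : η ≠ η') (hx : Rep M A C D ![e₀, η, e₂] x) (hy : Rep M A C D ![e₀, η', e₂] y) :
    y ∉ M.closure {x} := by
  obtain ⟨j, i, h, hji⟩ := hx.exists_line he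
  intro hyx
  have := closure_singleton_subset_line hji hyx
  rw [hy.mem_line_iff] at this
  exact hη (h.symm.trans this)

theorem Aligned.mem_closure_pair {e₀ e₂ η η' : K} {x y : α} (h : Aligned M A C D e₀ e₂)
    (he : ¬ (e₀ = 0 ∧ e₂ = 0)) (hη : η ≠ η') (hx : Rep M A C D ![e₀, η, e₂] x)
    (hy : Rep M A C D ![e₀, η', e₂] y) : D ∈ M.closure {x, y} := by
  by_contra hD
  refine Rep.notMem_closure_singleton_of_ne he hη hx hy (mem_closure_singleton_of_mem_pair ?_ hD)
  exact h _ _ _ _ hx hy (by simp [mul_comm]) (by simp [mul_comm]) he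

theorem Frame.hp_of_aligned (hF : Frame M A C D) {u v : Fin 3 → K} {k : K}
    (huv : u 0 * v 2 - u 2 * v 0 ≠ 0) (hk : k ≠ 0) (hu : Aligned M A C D (u 0) (u 2))
    (hv : Aligned M A C D (v 0) (v 2)) (huv' : Aligned M A C D (u 0 + v 0) (u 2 + v 2))
    {y x z o r s : α} (hy : Rep M A C D u y) (hx : Rep M A C D (u + v) x)
    (hz : Rep M A C D v z) (ho : Rep M A C D (u + ![0, k, 0]) o)
    (hr : Rep M A C D (v + ![0, k, 0]) r) (hs : Rep M A C D (u + v + ![0, k, 0]) s) :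
    HP M y x z o D r s := by
  have hD : Rep M A C D ![0, k, 0] D := by simpa using hF.repD.smul hk
  refine hF.hp (u := u) (v := v) (w := ![0, k, 0]) ?_ hy hx hz ho hD hr hs
    (colPair_of_ne_zero huv) ?_ ?_ (colPair_of_ne_zero ?_) (colPair_of_ne_zero ?_) ?_
  · have : det3 u v ![0, k, 0] = -k * (u 0 * v 2 - u 2 * v 0) := by simp [det3]; ring
    rw [this]
    exact mul_ne_zero (neg_ne_zero.2 hk) huv
  · refine hu.colPair (mul_comm _ _) (by simp) fun h => huv ?_
    simp [h.1, h.2]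
  · refine hv.colPair (mul_comm _ _) (by simp) fun h => huv ?_
    simp [h.1, h.2]
  · simpa using huv
  · intro h
    apply huv
    simp only [Pi.add_apply, Matrix.cons_val] at h
    linear_combination -h
  · refine huv'.colPair (mul_comm _ _) (by simp) fun h => huv ?_
    simp only [Pi.add_apply] at h
    linear_combination v 2 * h.1 - v 0 * h.2

/-- Take y = [a₀, η, a₂], z = [b₀, 0, b₂] and shift both by k along `D` to obtain o and r. The
conjugate of y + z does not depend on k, so it lies on all lines or, and varying k makes these sweep
out the lines through y - z. -/
theorem Frame.conc_sub (hF : Frame M A C D) (hM : IsHarmonic M)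
    (hl : ∀ e ∈ M.E, M.IsNonloop e) {a₀ a₂ b₀ b₂ : K} (hab : a₀ * b₂ - a₂ * b₀ ≠ 0)
    (ca : Conc M A C D a₀ a₂) (cb : Conc M A C D b₀ b₂) (cab : Conc M A C D (a₀ + b₀) (a₂ + b₂))
    (la : Aligned M A C D a₀ a₂) (lb : Aligned M A C D b₀ b₂)
    (lab : Aligned M A C D (a₀ + b₀) (a₂ + b₂)) : Conc M A C D (a₀ - b₀) (a₂ - b₂) := by
  intro η
  have hne : ¬ (a₀ - b₀ = 0 ∧ a₂ - b₂ = 0) := fun h => hab (by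
    linear_combination b₂ * h.1 - b₀ * h.2)
  obtain ⟨j₀, i₀, hu₁, hv₁⟩ : ∃ j i : K, j * (a₀ - b₀) + i * (a₂ - b₂) = η ∧
      j * b₀ + i * b₂ = 0 := by
    refine exists_line_params (u := ![a₀ - b₀, 0, a₂ - b₂]) (v := ![b₀, 0, b₂]) ?_ η 0
    simp only [Matrix.cons_val]
    intro h
    apply hab
    linear_combination h
  have hu₁' : j₀ * a₀ + i₀ * a₂ = η := by linear_combination hu₁ + hv₁
  obtain ⟨y, hy⟩ := ca η
  obtain ⟨z, hz⟩ := cb 0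
  obtain ⟨x, hx⟩ := cab.exists_rep (![a₀, η, a₂] + ![b₀, 0, b₂]) (by simp) (by simp)
  have key : ∀ k, k ≠ 0 → ∃ o r, Rep M A C D (![a₀, η, a₂] + ![0, k, 0]) o ∧
      Rep M A C D (![b₀, 0, b₂] + ![0, k, 0]) r ∧ ∃ s, HP M y x z o D r s := by
    intro k hk
    obtain ⟨o, ho⟩ := ca.exists_rep (![a₀, η, a₂] + ![0, k, 0]) (by simp) (by simp)
    obtain ⟨r, hr⟩ := cb.exists_rep (![b₀, 0, b₂] + ![0, k, 0]) (by simp) (by simp)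
    obtain ⟨s, hs⟩ := cab.exists_rep (![a₀, η, a₂] + ![b₀, 0, b₂] + ![0, k, 0])
      (by simp) (by simp)
    exact ⟨o, r, ho, hr, s, hF.hp_of_aligned hab hk la lb lab hy hx hz ho hr hs⟩
  obtain ⟨o, r, ho, hr, s, hs⟩ := key 1 one_ne_zero
  obtain ⟨x', hx'⟩ := hM.exists_conj _ _ _ _ _ _ _ hs
  have hmem : x' ∈ M.closure {y, z} := (hx'.ge (mem_singleton x')).1
  refine ⟨x', hF.rep_of_mem_line (hl x' (M.closure_subset_ground _ hmem)) hne fun j i hji => ?_⟩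
  simp only [Matrix.cons_val] at hji
  by_cases hk : j * b₀ + i * b₂ = 0
  · refine closure_pair_subset_line ?_ ?_ hmem
    · rw [hy.mem_line_iff]
      simp only [Matrix.cons_val]
      linear_combination hji + hk
    · rw [hz.mem_line_iff]
      simpa using hk
  -- For the shift k = j b₀ + i b₂, both o' and r' lie on the prescribed line (j, i).
  · obtain ⟨o', r', ho', hr', s', hs'⟩ := key _ hk
    obtain ⟨x'', hx''⟩ := hM.exists_conj _ _ _ _ _ _ _ hs'
    obtain rfl := hM.unique_conj y z x x' x'' ⟨o, D, r, s, hs, hx'⟩ ⟨o', D, r', s', hs', hx''⟩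
    refine closure_pair_subset_line ?_ ?_ (hx''.ge (mem_singleton x')).2
    · rw [ho'.mem_line_iff]
      simp only [Matrix.cons_val, Pi.add_apply]
      linear_combination hji
    · rw [hr'.mem_line_iff]
      simp only [Matrix.cons_val, Pi.add_apply]
      ring

/-- With q in direction e - f, the points o = y + q and r = z + q have direction e. Only y, x, z
need alignment; the other five triples have nonzero minors, that of x, q, s carrying the factor 2.
Alignment of e is not needed, so the configuration can be used to prove it. -/
theorem Frame.hp_of_direction (hF : Frame M A C D) (h2 : (2 : K) ≠ 0) {e₀ e₂ f₀ f₂ η η' : K}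
    (hef : e₀ * f₂ - e₂ * f₀ ≠ 0) (hη : η ≠ η') (hf : Aligned M A C D f₀ f₂) {y x z o q r s : α}
    (hy : Rep M A C D ![f₀, η, f₂] y) (hz : Rep M A C D ![f₀, η', f₂] z)
    (hx : Rep M A C D ![f₀ + f₀, η + η', f₂ + f₂] x) (hq : Rep M A C D ![e₀ - f₀, 0, e₂ - f₂] q)
    (ho : Rep M A C D ![e₀, η, e₂] o) (hr : Rep M A C D ![e₀, η', e₂] r)
    (hs : Rep M A C D ![e₀ + f₀, η + η', e₂ + f₂] s) : HP M y x z o q r s := by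
  have hf0 : ¬ (f₀ = 0 ∧ f₂ = 0) := by
    rintro ⟨rfl, rfl⟩
    simp at hef
  have e1 : ![f₀, η, f₂] + ![f₀, η', f₂] = ![f₀ + f₀, η + η', f₂ + f₂] := by simp
  refine hF.hp (u := ![f₀, η, f₂]) (v := ![f₀, η', f₂]) (w := ![e₀ - f₀, 0, e₂ - f₂]) ?_
    hy (by simpa using hx) hz (by simpa using ho) hq (by simpa using hr) ?_
    (hf.colPair (by simp [mul_comm]) (by simp [mul_comm]) (by simpa using hf0))
    (colPair_of_ne_zero ?_) (colPair_of_ne_zero ?_) (colPair_of_ne_zero ?_)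
    (colPair_of_ne_zero ?_) (colPair_of_ne_zero ?_)
  · have : det3 ![f₀, η, f₂] ![f₀, η', f₂] ![e₀ - f₀, 0, e₂ - f₂] =
        (η' - η) * -(e₀ * f₂ - e₂ * f₀) := by
      simp [det3]; ring
    rw [this]
    exact mul_ne_zero (sub_ne_zero.2 hη.symm) (neg_ne_zero.2 hef)
  · convert hs using 1
    simp only [Matrix.cons_add, Matrix.head_cons, Matrix.tail_cons, Matrix.empty_add_empty]
    congr 1
    · ring
    · congr 1
      · ring
      · congr 1
        ring
  all_goals
    intro h
    simp only [Pi.add_apply, Matrix.cons_val] at h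
  · exact hef (by linear_combination -h)
  · exact hef (by linear_combination -h)
  · exact hef (by linear_combination -h)
  · exact hef (by linear_combination -h)
  · exact mul_ne_zero h2 hef (by linear_combination -h)

/-- When e and f are both aligned, `D` lies on yz and on or, so it is the conjugate. -/
theorem Frame.fixConj (hF : Frame M A C D) (hM : IsHarmonic M) (h2 : (2 : K) ≠ 0)
    {e₀ e₂ f₀ f₂ : K} (hef : e₀ * f₂ - e₂ * f₀ ≠ 0) (le : Aligned M A C D e₀ e₂)
    (lf : Aligned M A C D f₀ f₂) (ce : Conc M A C D e₀ e₂)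
    (csub : Conc M A C D (e₀ - f₀) (e₂ - f₂)) (cadd : Conc M A C D (e₀ + f₀) (e₂ + f₂)) :
    FixConj M A C D f₀ f₂ := by
  intro η η' y z x hη hy hz hx
  obtain ⟨q, hq⟩ := csub 0
  obtain ⟨o, ho⟩ := ce η
  obtain ⟨r, hr⟩ := ce η'
  obtain ⟨s, hs⟩ := cadd (η + η')
  have hp := hF.hp_of_direction h2 hef hη lf hy hz hx hq ho hr hs
  obtain ⟨x', hx'⟩ := hM.exists_conj _ _ _ _ _ _ _ hp
  have he : ¬ (e₀ = 0 ∧ e₂ = 0) := by rintro ⟨rfl, rfl⟩; simp at hef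
  have hf : ¬ (f₀ = 0 ∧ f₂ = 0) := by rintro ⟨rfl, rfl⟩; simp at hef
  have hD : D ∈ M.closure {y, z} ∩ M.closure {o, r} :=
    ⟨lf.mem_closure_pair hf hη hy hz, le.mem_closure_pair he hη ho hr⟩
  rw [hx', mem_singleton_iff] at hD
  exact ⟨o, q, r, s, hp, hD ▸ hx'⟩

theorem Rep.exists_normalized {e₀ e₂ : K} {v : Fin 3 → K} {a : α} (h : Rep M A C D v a)
    (he : ¬ (e₀ = 0 ∧ e₂ = 0)) (hv : v 0 * e₂ = v 2 * e₀) (hne : ¬ (v 0 = 0 ∧ v 2 = 0)) :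
    ∃ η, Rep M A C D ![e₀, η, e₂] a := by
  obtain ⟨c, hc, h0, h2⟩ : ∃ c : K, c ≠ 0 ∧ c * v 0 = e₀ ∧ c * v 2 = e₂ := by
    by_cases hv0 : v 0 = 0
    · have hv2 : v 2 ≠ 0 := fun hv2 => hne ⟨hv0, hv2⟩
      have he0 : e₀ = 0 := by
        rw [hv0, zero_mul, zero_eq_mul] at hv
        exact hv.resolve_left hv2
      refine ⟨e₂ / v 2, div_ne_zero (fun h => he ⟨he0, h⟩) hv2, ?_, by field_simp⟩
      rw [hv0, he0, mul_zero]
    · have h2 : e₀ / v 0 * v 2 = e₂ := by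
        field_simp
        linear_combination -hv
      refine ⟨e₀ / v 0, fun h0 => he ?_, by field_simp, h2⟩
      have he0 : e₀ = 0 := (div_eq_zero_iff.1 h0).resolve_right hv0
      exact ⟨he0, by rw [← h2, he0]; simp⟩
  refine ⟨c * v 1, ?_⟩
  have := h.smul hc
  convert this using 1
  ext k
  fin_cases k <;> simp [h0, h2]

/-- The converse use of the same quadrangle: the conjugate is already known to be `D`, hence `D`
lies on or, and exchange puts r on the line oD. -/
theorem Frame.aligned (hF : Frame M A C D) (hM : IsHarmonic M) (h2 : (2 : K) ≠ 0)
    {e₀ e₂ f₀ f₂ : K} (hef : e₀ * f₂ - e₂ * f₀ ≠ 0) (hf : FixConj M A C D f₀ f₂)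
    (lf : Aligned M A C D f₀ f₂) (cf : Conc M A C D f₀ f₂)
    (csub : Conc M A C D (e₀ - f₀) (e₂ - f₂)) (cadd : Conc M A C D (e₀ + f₀) (e₂ + f₂)) :
    Aligned M A C D e₀ e₂ := by
  have he : ¬ (e₀ = 0 ∧ e₂ = 0) := by rintro ⟨rfl, rfl⟩; simp at hef
  intro a b o r ho hr ha hb hne
  by_cases hbD : b 0 = 0 ∧ b 2 = 0
  · rw [hr.eq_of_eq_zero hbD.1 hbD.2]
    exact M.mem_closure_of_mem' (by simp) hF.repD.mem_ground
  have hDo := hF.notMem_closure_singleton ho hne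
  obtain ⟨η, ho⟩ := ho.exists_normalized he ha hne
  obtain ⟨η', hr⟩ := hr.exists_normalized he hb hbD
  by_cases hη : η = η'
  · subst hη
    exact M.closure_subset_closure (by simp) (hF.mem_closure_of_rep ho hr)
  obtain ⟨y, hy⟩ := cf η
  obtain ⟨z, hz⟩ := cf η'
  obtain ⟨x, hx⟩ := (cf.smul h2).exists_rep ![f₀ + f₀, η + η', f₂ + f₂] (by simp [two_mul])
    (by simp [two_mul])
  obtain ⟨q, hq⟩ := csub 0
  obtain ⟨s, hs⟩ := cadd (η + η')
  have hp := hF.hp_of_direction h2 hef hη lf hy hz hx hq ho hr hs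
  obtain ⟨x', hx'⟩ := hM.exists_conj _ _ _ _ _ _ _ hp
  obtain rfl := hM.unique_conj _ _ _ _ _ (hf η η' y z x hη hy hz hx) ⟨o, q, r, s, hp, hx'⟩
  have hD := (hx'.ge (mem_singleton D)).2
  by_contra hr'
  exact hDo (mem_closure_singleton_of_mem_pair hD hr')

/-- The conjunction of `Conc` and `Aligned`. -/
def GoodDir (M : Matroid α) (A C : K → α) (D : α) (e₀ e₂ : K) : Prop :=
  Conc M A C D e₀ e₂ ∧ Aligned M A C D e₀ e₂

theorem GoodDir.smul {e₀ e₂ : K} (h : GoodDir M A C D e₀ e₂) {c d₀ d₂ : K} (hc : c ≠ 0)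
    (h0 : d₀ = c * e₀) (h2 : d₂ = c * e₂) : GoodDir M A C D d₀ d₂ := by
  subst h0 h2
  exact ⟨h.1.smul hc, h.2.smul hc⟩

theorem Frame.conc_of_goodDir (hF : Frame M A C D) (hM : IsHarmonic M)
    (hl : ∀ e ∈ M.E, M.IsNonloop e) {a₀ a₂ b₀ b₂ c₀ c₂ d₀ d₂ : K}
    (hab : a₀ * b₂ - a₂ * b₀ ≠ 0)
    (ga : GoodDir M A C D a₀ a₂) (gb : GoodDir M A C D b₀ b₂) (gc : GoodDir M A C D c₀ c₂)
    (hc₀ : c₀ = a₀ + b₀) (hc₂ : c₂ = a₂ + b₂) (hd₀ : d₀ = a₀ - b₀) (hd₂ : d₂ = a₂ - b₂) :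
    Conc M A C D d₀ d₂ := by
  subst hc₀ hc₂ hd₀ hd₂
  exact hF.conc_sub hM hl hab ga.1 gb.1 gc.1 ga.2 gb.2 gc.2

theorem Frame.goodDir_step (hF : Frame M A C D) (hM : IsHarmonic M)
    (hl : ∀ e ∈ M.E, M.IsNonloop e) (h2 : (2 : K) ≠ 0) (hA : GoodDir M A C D 0 1)
    (hfix : FixConj M A C D (0 : K) 1) {t : K} (g₀ : GoodDir M A C D 1 (t - 1))
    (g₁ : GoodDir M A C D 1 t) (g₂ : GoodDir M A C D 1 (t + 1)) : GoodDir M A C D 1 (t + 2) := by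
  have c₃ : Conc M A C D 1 (t + 2) :=
    hF.conc_of_goodDir hM hl (a₀ := 1) (a₂ := t + 1) (b₀ := 0) (b₂ := -1) (by simp) g₂
      (hA.smul (c := -1) (by simp) (by simp) (by simp)) g₁ (by ring) (by ring) (by ring) (by ring)
  -- The direction (1, t + 3) serves only as e + f in `Frame.aligned`, with e = (1, t + 2) and f =
  -- (0, 1).
  have c₄ : Conc M A C D 1 (t + 3) :=
    hF.conc_of_goodDir hM hl (a₀ := 1) (a₂ := t + 1) (b₀ := 0) (b₂ := -2) (by simpa using h2) g₂
      (hA.smul (c := -2) (by simpa using h2) (by simp) (by simp)) g₀ (by ring) (by ring) (by ring)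
      (by ring)
  refine ⟨c₃, hF.aligned hM h2 (f₀ := 0) (f₂ := 1) (by simp) hfix hA.2 hA.1 ?_ ?_⟩
  · convert g₂.1 using 1 <;> ring
  · convert c₄ using 1 <;> ring

theorem Frame.goodDir_natCast (hF : Frame M A C D) (hM : IsHarmonic M)
    (hl : ∀ e ∈ M.E, M.IsNonloop e) (h2 : (2 : K) ≠ 0) (hA : GoodDir M A C D 0 1)
    (hB : GoodDir M A C D 1 1) (hC : GoodDir M A C D 1 0) (n : ℕ) :
    GoodDir M A C D 1 (n : K) := by
  have cneg : Conc M A C D 1 (-1) :=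
    hF.conc_of_goodDir hM hl (a₀ := 1) (a₂ := 0) (b₀ := 0) (b₂ := 1) (by simp) hC hA hB
      (by ring) (by ring) (by ring) (by ring)
  have chalf : Conc M A C D 2 1 :=
    hF.conc_of_goodDir hM hl (a₀ := 1) (a₂ := 1) (b₀ := -1) (b₂ := 0) (by simp) hB
      (hC.smul (c := -1) (by simp) (by simp) (by simp)) hA (by ring) (by ring) (by ring) (by ring)
  have fixB : FixConj M A C D (1 : K) 1 :=
    hF.fixConj hM h2 (e₀ := 1) (e₂ := 0) (by simp) hC.2 hB.2 hC.1
      (hA.smul (c := -1) (by simp) (by simp) (by simp)).1 (by convert chalf using 1 <;> ring)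
  -- Using f = (0, 1) here would require (1, -2), not yet available. With f = (1, 1), both e - f and
  -- e + f are multiples of given directions.
  have hneg : GoodDir M A C D 1 (-1) := by
    refine ⟨cneg, hF.aligned hM h2 (f₀ := 1) (f₂ := 1) ?_ fixB hB.2 hB.1 ?_ ?_⟩
    · intro h
      apply h2
      linear_combination h
    · exact (hA.smul (c := -2) (by simpa using h2) (by simp) (by ring)).1
    · exact (hC.smul (c := 2) h2 (by ring) (by ring)).1
  have fixA : FixConj M A C D (0 : K) 1 :=
    hF.fixConj hM h2 (e₀ := 1) (e₂ := 0) (by simp) hC.2 hA.2 hC.1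
      (by convert cneg using 1 <;> ring) (by convert hB.1 using 1 <;> ring)
  -- `Frame.goodDir_step` consumes three consecutive directions, so the induction carries all three.
  have : GoodDir M A C D 1 ((n : K) - 1) ∧ GoodDir M A C D 1 (n : K) ∧
      GoodDir M A C D 1 ((n : K) + 1) := by
    induction n with
    | zero => simpa using ⟨hneg, hC, hB⟩
    | succ n ih =>
      obtain ⟨g₀, g₁, g₂⟩ := ih
      push_cast
      refine ⟨by simpa using g₁, g₂, ?_⟩
      have := hF.goodDir_step hM hl h2 hA fixA g₀ g₁ g₂
      rwa [add_assoc, one_add_one_eq_two]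
  exact this.2.1

end Directions

/-! ### All directions over a prime field -/

section Prime

theorem zmod_two_cases : ∀ t : ZMod 2, t = 0 ∨ t = 1 := by decide

variable {p : ℕ} [Fact p.Prime] {α : Type*} {M : Matroid α} {A C : ZMod p → α} {D : α}

theorem Frame.goodDir (hF : Frame M A C D) (hM : IsHarmonic M) (hl : ∀ e ∈ M.E, M.IsNonloop e)
    (hA : GoodDir M A C D 0 1) (hB : GoodDir M A C D 1 1) (hC : GoodDir M A C D 1 0)
    {e₀ e₂ : ZMod p} (he : ¬ (e₀ = 0 ∧ e₂ = 0)) : GoodDir M A C D e₀ e₂ := by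
  have key : ∀ t : ZMod p, GoodDir M A C D 1 t := by
    intro t
    -- The induction needs 2 to be invertible; for p = 2 the given directions are already all of
    -- them.
    by_cases h2 : (2 : ZMod p) = 0
    · have hp : p = 2 := by
        have : (p : ℕ) ∣ 2 := (ZMod.natCast_eq_zero_iff 2 p).1 (by exact_mod_cast h2)
        exact (Nat.prime_dvd_prime_iff_eq Fact.out Nat.prime_two).1 this
      subst hp
      rcases zmod_two_cases t with rfl | rfl
      · exact hC
      · exact hB
    · rw [← ZMod.natCast_zmod_val t]
      exact hF.goodDir_natCast hM hl h2 hA hB hC _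
  by_cases h0 : e₀ = 0
  · exact hA.smul (c := e₂) (fun h => he ⟨h0, h⟩) (by simp [h0]) (by simp)
  · exact (key (e₂ / e₀)).smul h0 (by simp) (by field_simp)

end Prime

/-! ### Formal properties of harmonic closure -/

section Closure

variable {α : Type*} {M : Matroid α} {S T : Set α} {a b c x : α}

theorem IsHarmonicConj.mem_closure (h : IsHarmonicConj M a c b x) : x ∈ M.closure {a, c} := by
  obtain ⟨o, q, r, s, -, h⟩ := h
  exact (h.ge (mem_singleton x)).1

theorem subset_harmonicClosure : S ⊆ harmonicClosure M S :=
  subset_iUnion (fun n : ℕ => (harmonicStep M)^[n] S) 0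

theorem harmonicClosure_subset (hST : S ⊆ T)
    (hT : ∀ a ∈ T, ∀ b ∈ T, ∀ c ∈ T, ∀ x, IsHarmonicConj M a c b x → x ∈ T) :
    harmonicClosure M S ⊆ T := by
  refine iUnion_subset fun n => ?_
  induction n with
  | zero => exact hST
  | succ n ih =>
    rw [Function.iterate_succ_apply']
    rintro x (hx | ⟨-, a, ha, b, hb, c, hc, hx⟩)
    · exact ih hx
    · exact hT a (ih ha) b (ih hb) c (ih hc) x hx

theorem IsHarmonicConj.mem_harmonicClosure (h : IsHarmonicConj M a c b x)
    (ha : a ∈ harmonicClosure M S) (hb : b ∈ harmonicClosure M S)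
    (hc : c ∈ harmonicClosure M S) : x ∈ harmonicClosure M S := by
  have hmono : Monotone fun n : ℕ => (harmonicStep M)^[n] S :=
    monotone_nat_of_le_succ fun n => by
      rw [Function.iterate_succ_apply']
      exact subset_union_left
  obtain ⟨k, ha⟩ := mem_iUnion.1 ha
  obtain ⟨l, hb⟩ := mem_iUnion.1 hb
  obtain ⟨m, hc⟩ := mem_iUnion.1 hc
  refine mem_iUnion.2 ⟨k + l + m + 1, ?_⟩
  rw [Function.iterate_succ_apply']
  exact Or.inr ⟨M.closure_subset_ground _ h.mem_closure, a, hmono (by omega) ha,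
    b, hmono (by omega) hb, c, hmono (by omega) hc, h⟩

theorem harmonicClosure_mono (h : S ⊆ T) : harmonicClosure M S ⊆ harmonicClosure M T :=
  harmonicClosure_subset (h.trans subset_harmonicClosure)
    fun _ ha _ hb _ hc _ hx => hx.mem_harmonicClosure ha hb hc

theorem harmonicClosure_subset_closure (hS : S ⊆ M.E) :
    harmonicClosure M S ⊆ M.closure S :=
  harmonicClosure_subset (M.subset_closure S hS) fun a ha _ _ c hc _ hx =>
    M.closure_subset_closure_of_subset_closure (by rintro y (rfl | rfl) <;> assumption)
      hx.mem_closure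

theorem mem_closure_of_eRk_le (hab : M.Indep {a, b}) (hne : a ≠ b) (h : M.eRk {a, b, c} ≤ 2)
    (hc : c ∈ M.E) : c ∈ M.closure {a, b} := by
  have := (M.isRkFinite_of_finite (toFinite {a, b})).closure_eq_closure_of_subset_of_eRk_ge_eRk
    (M := M) (X := {a, b}) (Y := {a, b, c}) (by rintro x (rfl | rfl) <;> simp)
    (by rwa [hab.eRk_eq_encard, encard_pair hne])
  rw [this]
  exact M.mem_closure_of_mem' (by simp) hc

end Closure

/-! ### Harmonic conjugation in the coordinatized plane -/

section Plane

variable {K α : Type*} [Field K] {M : Matroid α} {A C : K → α} {D : α}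

theorem Rep.mem_closure_of_colPair {u v w : Fin 3 → K} {a b c d : α} (hu : Rep M A C D u a)
    (hv : Rep M A C D v b) (hw : Rep M A C D w d) (hdet : det3 u v w ≠ 0)
    (hc : c ∈ M.E) (h : M.eRk {a, b, c} ≤ 2) : c ∈ M.closure {a, b} := by
  refine mem_closure_of_eRk_le ((hu.indep_triple hv hw hdet).subset ?_) ?_ h hc
  · rintro x (rfl | rfl) <;> simp
  · rintro rfl
    refine hu.notMem_closure_pair hw hv (fun h => hdet ?_)
      (M.mem_closure_of_mem' (by simp) hu.mem_ground)
    rw [← neg_eq_zero, ← h]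
    unfold det3
    ring

/-- All directions are good. -/
structure Plane (M : Matroid α) (A C : K → α) (D : α) : Prop extends Frame M A C D where
  good : ∀ e₀ e₂, ¬ (e₀ = 0 ∧ e₂ = 0) → GoodDir M A C D e₀ e₂

theorem Plane.exists_rep (hP : Plane M A C D) {v : Fin 3 → K} (hv : v ≠ 0) :
    ∃ a, Rep M A C D v a := by
  by_cases h : v 0 = 0 ∧ v 2 = 0
  · have h1 : v 1 ≠ 0 := fun h1 => hv (by ext k; fin_cases k <;> simp [h.1, h.2, h1])
    refine ⟨D, ?_⟩
    convert hP.repD.smul h1 using 1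
    ext k
    fin_cases k <;> simp [h.1, h.2]
  · exact (hP.good _ _ h).1.exists_rep v rfl rfl

theorem Plane.colPair (hP : Plane M A C D) (a b : Fin 3 → K) : ColPair M A C D a b := by
  by_cases h : a 0 * b 2 - a 2 * b 0 = 0
  swap
  · exact colPair_of_ne_zero h
  by_cases ha : a 0 = 0 ∧ a 2 = 0
  · by_cases hb : b 0 = 0 ∧ b 2 = 0
    · intro x y z hx hy hz
      rw [hx.eq_of_eq_zero ha.1 ha.2, hy.eq_of_eq_zero hb.1 hb.2,
        hz.eq_of_eq_zero (by simp [ha.1, hb.1]) (by simp [ha.2, hb.2])]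
      refine (M.eRk_le_encard _).trans ?_
      simp
    · exact ((hP.good _ _ hb).2.colPair (mul_comm _ _) (by simp [ha.1, ha.2]) hb).symm
  · exact (hP.good _ _ ha).2.colPair (mul_comm _ _) (by linear_combination -h) ha

/-- Since u - v = (u + w) - (v + w), its representative lies on both yz and or. -/
theorem Plane.isHarmonicConj (hP : Plane M A C D) (hM : IsHarmonic M) {u v w : Fin 3 → K}
    (hdet : det3 u v w ≠ 0) {y z x a : α} (hy : Rep M A C D u y) (hz : Rep M A C D v z)
    (hx : Rep M A C D (u + v) x) (ha : Rep M A C D (u - v) a) : IsHarmonicConj M y z x a := by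
  have hne : ∀ t, (t = 0 → det3 u v w = 0) → ∃ b, Rep M A C D t b := fun t ht =>
    hP.exists_rep fun h => hdet (ht h)
  have aux : ∀ t : Fin 3 → K, t = 0 → t 0 = 0 ∧ t 1 = 0 ∧ t 2 = 0 := by
    rintro t rfl
    simp
  obtain ⟨o, ho⟩ := hne (u + w) fun h => by
    obtain ⟨h0, h1, h2⟩ := aux _ h
    simp only [Pi.add_apply] at h0 h1 h2
    rw [det3, eq_neg_of_add_eq_zero_left h0, eq_neg_of_add_eq_zero_left h1,
      eq_neg_of_add_eq_zero_left h2]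
    ring
  obtain ⟨q, hq⟩ := hne w fun h => by simp [det3, h]
  obtain ⟨r, hr⟩ := hne (v + w) fun h => by
    obtain ⟨h0, h1, h2⟩ := aux _ h
    simp only [Pi.add_apply] at h0 h1 h2
    rw [det3, eq_neg_of_add_eq_zero_left h0, eq_neg_of_add_eq_zero_left h1,
      eq_neg_of_add_eq_zero_left h2]
    ring
  obtain ⟨s, hs⟩ := hne (u + v + w) fun h => by
    obtain ⟨h0, h1, h2⟩ := aux _ h
    simp only [Pi.add_apply] at h0 h1 h2
    rw [det3, eq_neg_of_add_eq_zero_right h0, eq_neg_of_add_eq_zero_right h1,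
      eq_neg_of_add_eq_zero_right h2]
    ring
  have hp := hP.hp hdet hy hx hz ho hq hr hs (hP.colPair _ _) (hP.colPair _ _) (hP.colPair _ _)
    (hP.colPair _ _) (hP.colPair _ _) (hP.colPair _ _)
  obtain ⟨x', hx'⟩ := hM.exists_conj _ _ _ _ _ _ _ hp
  have h1 : a ∈ M.closure {y, z} := by
    refine hy.mem_closure_of_colPair hz hq hdet ha.mem_ground ?_
    have := hP.colPair (u - v) v a z y ha hz (by simpa using hy)
    rwa [pair_comm z y, insert_comm, pair_comm a z] at this
  have h2 : a ∈ M.closure {o, r} := by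
    refine ho.mem_closure_of_colPair hr hq (fun h => hdet ?_) ha.mem_ground ?_
    · rw [← h]
      simp only [det3, Pi.add_apply]
      ring
    · have := hP.colPair (u - v) (v + w) a r o ha hr (by
        rwa [← add_assoc, sub_add_cancel])
      rwa [pair_comm r o, insert_comm, pair_comm a r] at this
  have h3 : a ∈ M.closure {y, z} ∩ M.closure {o, r} := ⟨h1, h2⟩
  rw [hx', mem_singleton_iff] at h3
  exact ⟨o, q, r, s, hp, h3 ▸ hx'⟩

/-- Testing against the standard basis reads off the cross product, which vanishes only for
proportional vectors. -/
theorem exists_det3_ne_zero {u v : Fin 3 → K} (hu : u ≠ 0) (hv : v ≠ 0)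
    (h : ∀ c : K, c ≠ 0 → v ≠ c • u) : ∃ w, det3 u v w ≠ 0 := by
  by_contra! hall
  have h0 := hall ![1, 0, 0]
  have h1 := hall ![0, 1, 0]
  have h2 := hall ![0, 0, 1]
  simp only [det3, Matrix.cons_val] at h0 h1 h2
  have key : ∀ k, u k ≠ 0 → (∀ l, v l * u k = v k * u l) → False := by
    intro k hk hl
    have hv' : v = (v k / u k) • u := by
      ext l
      simp only [Pi.smul_apply, smul_eq_mul]
      rw [div_mul_eq_mul_div, eq_div_iff hk, hl]
    refine h _ (fun h0 => hv ?_) hv'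
    rw [hv', h0, zero_smul]
  apply hu
  ext k
  by_contra hk
  refine key k hk fun l => ?_
  fin_cases k <;> fin_cases l <;> simp only [Fin.zero_eta, Fin.mk_one, Fin.reduceFinMk]
  · linear_combination h2
  · linear_combination -h1
  · linear_combination -h2
  · linear_combination h0
  · linear_combination h1
  · linear_combination -h0

/-- Incidences alone only make the two elements parallel. With d = [0, 1, 0], both are conjugates of
v + 2d with respect to v + d and d, so harmonicity identifies them. -/
theorem Plane.rep_unique (hP : Plane M A C D) (hM : IsHarmonic M) {v : Fin 3 → K} {a b : α}
    (ha : Rep M A C D v a) (hb : Rep M A C D v b) : a = b := by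
  by_cases h : v 0 = 0 ∧ v 2 = 0
  · rw [ha.eq_of_eq_zero h.1 h.2, hb.eq_of_eq_zero h.1 h.2]
  have hne : ∀ c : K, v + c • ![0, 1, 0] ≠ 0 := fun c hc => h
    ⟨by simpa using congrFun hc 0, by simpa using congrFun hc 2⟩
  obtain ⟨y, hy⟩ := hP.exists_rep (v := v + ![0, 1, 0]) (by simpa using hne 1)
  obtain ⟨x, hx⟩ := hP.exists_rep (v := v + ![0, 1, 0] + ![0, 1, 0]) (by
    rw [add_assoc, ← two_smul K]
    exact hne 2)
  obtain ⟨w, hw⟩ := exists_det3_ne_zero hy.ne_zero hP.repD.ne_zero fun c hc hcv => by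
    have h0 := congrFun hcv 0
    have h2 := congrFun hcv 2
    simp [hc] at h0 h2
    exact h ⟨h0, h2⟩
  exact hM.unique_conj _ _ _ _ _
    (hP.isHarmonicConj hM hw hy hP.repD hx (by rwa [add_sub_cancel_right]))
    (hP.isHarmonicConj hM hw hy hP.repD hx (by rwa [add_sub_cancel_right]))

theorem HP.not_indep_and_ne {y x z o q r s : α} (h : HP M y x z o q r s) :
    ¬ M.Indep {y, x, z} ∧ y ≠ x ∧ y ≠ z ∧ x ≠ z := by
  have hl : ({0, 1, 2} : Finset (Fin 7)) ∈ nonFanoLines := by decide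
  have himg : ![y, x, z, o, q, r, s] '' (({0, 1, 2} : Finset (Fin 7)) : Set (Fin 7)) =
      {y, x, z} := by
    simp [image_insert_eq]
  have aux : ∀ {N : Matroid (Fin 7)}, N.E = univ →
      ¬ N.Indep (({0, 1, 2} : Finset (Fin 7)) : Set (Fin 7)) →
      IsEmbedding N M ![y, x, z, o, q, r, s] →
      ¬ M.Indep {y, x, z} ∧ y ≠ x ∧ y ≠ z ∧ x ≠ z := by
    intro N hE hN h
    have hinj : ∀ i j : Fin 7, i ≠ j →
        ![y, x, z, o, q, r, s] i ≠ ![y, x, z, o, q, r, s] j := fun i j hij he =>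
      hij (h.injOn (by simp [hE]) (by simp [hE]) he)
    exact ⟨by rwa [← himg, h.indep_iff _ (by simp [hE])], hinj 0 1 (by decide),
      hinj 0 2 (by decide), hinj 1 2 (by decide)⟩
  rcases h with h | h
  · refine aux rfl ?_ h
    rw [fano, ofLines_indep]
    exact fun h => h.2 (Finset.mem_insert_of_mem hl)
  · refine aux rfl ?_ h
    rw [nonFano, ofLines_indep]
    exact fun h => h.2 hl

/-- Collinearity and distinctness give v = k u + l w with k, l nonzero. The representative of k u -
l w is then a conjugate, hence equal to `x`. -/
theorem Plane.exists_rep_of_isHarmonicConj (hP : Plane M A C D) (hM : IsHarmonic M)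
    {u v w : Fin 3 → K} {a b c x : α} (ha : Rep M A C D u a) (hb : Rep M A C D v b)
    (hc : Rep M A C D w c) (h : IsHarmonicConj M a c b x) : ∃ t, Rep M A C D t x := by
  obtain ⟨o, q, r, s, hp, -⟩ := id h
  obtain ⟨hi, hab, hac, hbc⟩ := hp.not_indep_and_ne
  have hne : ∀ {u v : Fin 3 → K} {a b : α}, Rep M A C D u a → Rep M A C D v b → a ≠ b →
      ∀ k : K, k ≠ 0 → v ≠ k • u := by
    rintro u v a b ha hb hab k hk rfl
    exact hab (hP.rep_unique hM (ha.smul hk) hb)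
  obtain ⟨t, ht⟩ := exists_det3_ne_zero ha.ne_zero hc.ne_zero (hne ha hc hac)
  have hdet : det3 u v w = 0 := by
    by_contra hdet
    exact hi (ha.indep_triple hb hc hdet)
  -- Cramer's rule in the basis u, w, t; the t-coefficient vanishes by `hdet`.
  have hv : v = (det3 v w t / det3 u w t) • u + (det3 u v t / det3 u w t) • w := by
    ext k
    simp only [Pi.add_apply, Pi.smul_apply, smul_eq_mul]
    rw [div_mul_eq_mul_div, div_mul_eq_mul_div, ← add_div, eq_div_iff ht]
    unfold det3 at hdet ⊢
    fin_cases k <;> simp only [Fin.zero_eta, Fin.mk_one, Fin.reduceFinMk]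
    · linear_combination -t 0 * hdet
    · linear_combination -t 1 * hdet
    · linear_combination -t 2 * hdet
  set k := det3 v w t / det3 u w t
  set l := det3 u v t / det3 u w t
  have hk : k ≠ 0 := by
    intro hk
    rw [hk, zero_smul, zero_add] at hv
    refine hne hc hb hbc.symm l (fun hl => hb.ne_zero ?_) hv
    rw [hv, hl, zero_smul]
  have hl : l ≠ 0 := by
    intro hl
    rw [hl, zero_smul, add_zero] at hv
    exact hne ha hb hab k hk hv
  have hdet' : det3 (k • u) (l • w) t ≠ 0 := by
    have : det3 (k • u) (l • w) t = k * l * det3 u w t := by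
      simp only [det3, Pi.smul_apply, smul_eq_mul]
      ring
    rw [this]
    exact mul_ne_zero (mul_ne_zero hk hl) ht
  obtain ⟨x₀, hx₀⟩ := hP.exists_rep (v := k • u - l • w) fun h0 => hdet' (by
    rw [sub_eq_zero.1 h0]
    unfold det3
    ring)
  refine ⟨_, (hM.unique_conj _ _ _ _ _ h
    (hP.isHarmonicConj hM hdet' (ha.smul hk) (hc.smul hl) (hv ▸ hb) hx₀)) ▸ hx₀⟩

end Plane

/-! ### Generating a line by harmonic conjugation -/

section Prime

variable {p : ℕ} [Fact p.Prime] {α : Type*} {M : Matroid α} {A B C : ZMod p → α} {D : α}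

/-- Up to scaling, the points of the line are `A i` and C + nA, where C = [1, j, 0] and A = [0, i,
1]. The cases n = 0, 1 are `C j` and `B (i + j)`; each later one is a conjugate involving the
preceding two. -/
theorem Plane.mem_harmonicClosure (hP : Plane M A C D) (hM : IsHarmonic M)
    (hB : ∀ k, Rep M A C D ![1, k, 1] (B k)) {j i : ZMod p} {v : Fin 3 → ZMod p} {a : α}
    (ha : Rep M A C D v a) (hv : j * v 0 + i * v 2 = v 1) :
    a ∈ harmonicClosure M {A i, B (i + j), C j} := by
  have hmem : ∀ x ∈ ({A i, B (i + j), C j} : Set α),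
      x ∈ harmonicClosure M {A i, B (i + j), C j} := fun x hx => subset_harmonicClosure hx
  have key : ∀ n : ℕ, (∀ a, Rep M A C D ![1, j + i * n, (n : ZMod p)] a →
      a ∈ harmonicClosure M {A i, B (i + j), C j}) ∧
      (∀ a, Rep M A C D ![1, j + i * (n + 1), (n : ZMod p) + 1] a →
      a ∈ harmonicClosure M {A i, B (i + j), C j}) := by
    intro n
    induction n with
    | zero =>
      refine ⟨fun a ha => ?_, fun a ha => ?_⟩
      · rw [hP.rep_unique hM ha (by simpa using hP.repC j)]
        exact hmem _ (by simp)
      · rw [hP.rep_unique hM ha (by simpa [add_comm j] using hB (i + j))]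
        exact hmem _ (by simp)
    | succ n ih =>
      push_cast
      refine ⟨ih.2, fun a ha => ?_⟩
      obtain ⟨y, hy⟩ := (hP.good 1 ((n : ZMod p) + 1) (by simp)).1 (j + i * (n + 1))
      obtain ⟨x, hx⟩ := (hP.good 1 (n : ZMod p) (by simp)).1 (j + i * n)
      -- For u = C + (n + 1)A and v = -A, the sum is C + nA and the difference is C + (n + 2)A; [0,
      -- 1, 0] is off the line.
      refine (hP.isHarmonicConj hM (u := ![1, j + i * (n + 1), (n : ZMod p) + 1])
        (v := (-1 : ZMod p) • ![0, i, 1]) (w := ![0, 1, 0]) (by simp [det3]) hy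
        ((hP.repA i).smul (by simp)) (x := x) ?_ ?_).mem_harmonicClosure (ih.2 y hy) (ih.1 x hx)
        (hmem _ (by simp))
      · convert hx using 1
        simp
        ring
      · convert ha using 1
        simp
        ring
  by_cases h0 : v 0 = 0
  · rw [h0, mul_zero, zero_add] at hv
    have h2 : v 2 ≠ 0 := by
      intro h2
      apply ha.ne_zero
      rw [h2, mul_zero] at hv
      ext k
      fin_cases k <;> simp [h0, h2, ← hv]
    rw [hP.rep_unique hM ha (b := A i)]
    · exact hmem _ (by simp)
    · convert (hP.repA i).smul h2 using 1
      ext k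
      fin_cases k <;> simp [h0, ← hv, mul_comm]
  · refine (key (v 2 / v 0).val).1 a ?_
    rw [ZMod.natCast_zmod_val]
    convert ha.smul (inv_ne_zero h0) using 1
    ext k
    fin_cases k
    · simp [h0]
    · simp [← hv]
      field_simp
    · simp
      field_simp

theorem Frame.goodDir_of_family {K : Type*} [Field K] {A C : K → α} (hF : Frame M A C D)
    {e₀ e₂ : K} (he : ¬ (e₀ = 0 ∧ e₂ = 0)) {P : K → α} (hP : ∀ η, Rep M A C D ![e₀, η, e₂] (P η))
    (hPD : ∀ η η', P η' ∈ M.closure {P η, D}) : GoodDir M A C D e₀ e₂ := by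
  refine ⟨fun η => ⟨_, hP η⟩, fun a b x y hx hy ha hb hne => ?_⟩
  have hD : ∀ z, D ∈ M.closure {z, D} := fun z =>
    M.mem_closure_of_mem' (by simp) hF.repD.mem_ground
  by_cases hbD : b 0 = 0 ∧ b 2 = 0
  · rw [hy.eq_of_eq_zero hbD.1 hbD.2]
    exact hD x
  obtain ⟨η, hx⟩ := hx.exists_normalized he ha hne
  obtain ⟨η', hy⟩ := hy.exists_normalized he hb hbD
  have h1 : P η ∈ M.closure {x, D} :=
    M.closure_subset_closure (by simp) (hF.mem_closure_of_rep hx (hP η))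
  have h2 : P η' ∈ M.closure {x, D} :=
    M.closure_subset_closure_of_subset_closure (by rintro z (rfl | rfl); exacts [h1, hD x])
      (hPD η η')
  exact M.closure_subset_closure_of_subset_closure (by rintro z rfl; exact h2)
    (hF.mem_closure_of_rep (hP η') hy)

/-- The harmonic closure of a line of a frame in a harmonic matroid. -/
theorem Frame.harmonicClosure_eq (hF : Frame M A C D) (hM : IsHarmonic M)
    (hB : ∀ k, Rep M A C D ![1, k, 1] (B k)) (gA : GoodDir M A C D 0 1)
    (gB : GoodDir M A C D 1 1) (gC : GoodDir M A C D 1 0) (j i : ZMod p) :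
    harmonicClosure M {A i, B (i + j), C j} = M.closure {A i, B (i + j), C j} ∩
      harmonicClosure M (range A ∪ range B ∪ range C ∪ {D}) := by
  have hsub : ({A i, B (i + j), C j} : Set α) ⊆ range A ∪ range B ∪ range C ∪ {D} := by
    rintro x (rfl | rfl | rfl) <;> simp
  have hE : ({A i, B (i + j), C j} : Set α) ⊆ M.E := by
    rintro x (rfl | rfl | rfl)
    exacts [(hF.repA _).mem_ground, (hB _).mem_ground, (hF.repC _).mem_ground]
  have hline : M.closure {A i, B (i + j), C j} ⊆ line M A C j i :=
    M.closure_subset_closure_of_subset_closure (by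
      rintro x (rfl | rfl | rfl)
      · exact ((hF.repA i).mem_line_iff j i).2 (by simp)
      · exact ((hB (i + j)).mem_line_iff j i).2 (by simp [add_comm])
      · exact ((hF.repC j).mem_line_iff j i).2 (by simp))
  refine subset_antisymm
    (subset_inter (harmonicClosure_subset_closure hE) (harmonicClosure_mono hsub)) ?_
  have hLrep : ∀ x ∈ range A ∪ range B ∪ range C ∪ {D}, ∃ v, Rep M A C D v x := by
    rintro x (((⟨k, rfl⟩ | ⟨k, rfl⟩) | ⟨k, rfl⟩) | rfl)
    exacts [⟨_, hF.repA k⟩, ⟨_, hB k⟩, ⟨_, hF.repC k⟩, ⟨_, hF.repD⟩]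
  rintro x ⟨hx, hxL⟩
  by_cases hl : ∀ e ∈ M.E, M.IsNonloop e
  · have hP : Plane M A C D := { hF with good := fun e₀ e₂ he => hF.goodDir hM hl gA gB gC he }
    have hrep : harmonicClosure M (range A ∪ range B ∪ range C ∪ {D}) ⊆
        {x | ∃ v, Rep M A C D v x} := by
      refine harmonicClosure_subset hLrep ?_
      rintro a ⟨u, ha⟩ b ⟨v, hb⟩ c ⟨w, hc⟩ x hx
      exact hP.exists_rep_of_isHarmonicConj hM ha hb hc hx
    obtain ⟨v, hv⟩ := hrep hxL
    exact hP.mem_harmonicClosure hM hB hv ((hv.mem_line_iff j i).1 (hline hx))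
  · push Not at hl
    obtain ⟨e, heE, he⟩ := hl
    rw [Matroid.not_isNonloop_iff, Matroid.isLoop_iff] at he
    -- A loop belongs to every closure, hence to each singleton intersection.
    have hconj : ∀ a b c x, IsHarmonicConj M a c b x → e = x := by
      rintro a b c x ⟨o, q, r, s, -, h⟩
      have : e ∈ M.closure {a, c} ∩ M.closure {o, r} :=
        ⟨M.closure_subset_closure (empty_subset _) he,
          M.closure_subset_closure (empty_subset _) he⟩
      rw [h] at this
      exact this
    have hxe : x = e ∨ x ∈ range A ∪ range B ∪ range C ∪ {D} := by
      have : harmonicClosure M (range A ∪ range B ∪ range C ∪ {D}) ⊆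
          insert e (range A ∪ range B ∪ range C ∪ {D}) :=
        harmonicClosure_subset (subset_insert _ _) fun a _ b _ c _ x hx =>
          Or.inl (hconj a b c x hx).symm
      exact this hxL
    rcases hxe with rfl | hxL
    -- The loop is in the harmonic closure of the three points: a configuration made of the given
    -- points alone yields a conjugate of `B (i + j)`, which must be the loop.
    · have hp := hF.hp_of_aligned (u := ![0, i, 1]) (v := ![1, j, 0]) (k := 1) (by simp) (by simp)
        gA.2 gC.2 (by simpa using gB.2) (hF.repA i) (x := B (i + j)) (by simpa using hB (i + j))
        (hF.repC j) (o := A (i + 1)) (by simpa using hF.repA (i + 1)) (r := C (j + 1))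
        (by simpa using hF.repC (j + 1)) (s := B (i + j + 1)) (by simpa using hB (i + j + 1))
      obtain ⟨x', hx'⟩ := hM.exists_conj _ _ _ _ _ _ _ hp
      have hc : IsHarmonicConj M (A i) (C j) (B (i + j)) x' := ⟨_, _, _, _, hp, hx'⟩
      obtain rfl := hconj _ _ _ _ hc
      exact hc.mem_harmonicClosure (subset_harmonicClosure (by simp))
        (subset_harmonicClosure (by simp)) (subset_harmonicClosure (by simp))
    · refine subset_harmonicClosure ?_
      have hx' := hline hx
      rcases hxL with ((⟨k, rfl⟩ | ⟨k, rfl⟩) | ⟨k, rfl⟩) | rfl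
      · rw [(hF.repA k).mem_line_iff] at hx'
        simp at hx'
        simp [hx']
      · rw [(hB k).mem_line_iff] at hx'
        simp at hx'
        simp [← hx', add_comm]
      · rw [(hF.repC k).mem_line_iff] at hx'
        simp at hx'
        simp [hx']
      · exact absurd hx' (hF.notMem_line j i)

end Prime

/-! ### From the embedding of `L_p` to a frame -/

section Embedding

variable {p : ℕ} [Fact p.Prime] {α : Type*} {M : Matroid α} {φ : ProjPlane p → α}

theorem PG2_indep_iff (I : Set (ProjPlane p)) :
    (PG2 p).Indep I ↔ LinearIndepOn (ZMod p) Projectivization.rep I :=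
  Projectivization.independent_iff

theorem Lp_indep_iff {I : Set (ProjPlane p)} (hI : I ⊆ (Lp p).E) :
    (Lp p).Indep I ↔ LinearIndepOn (ZMod p) Projectivization.rep I := by
  rw [Lp, Matroid.restrict_indep_iff, PG2_indep_iff]
  exact and_iff_left hI

theorem rep_mem_span_iff {V : Type*} [AddCommGroup V] {K : Type*} [Field K] [Module K V]
    {u v w : V} (hu : u ≠ 0) (hv : v ≠ 0) (hw : w ≠ 0) :
    (Projectivization.mk K w hw).rep ∈ Submodule.span K
      (Projectivization.rep '' {Projectivization.mk K u hu, Projectivization.mk K v hv}) ↔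
      ∃ a b : K, a • u + b • v = w := by
  obtain ⟨k, hk⟩ := Projectivization.exists_smul_eq_mk_rep K u hu
  obtain ⟨l, hl⟩ := Projectivization.exists_smul_eq_mk_rep K v hv
  obtain ⟨m, hm⟩ := Projectivization.exists_smul_eq_mk_rep K w hw
  rw [image_pair, ← hk, ← hl, ← hm, Submodule.mem_span_pair]
  constructor
  · rintro ⟨a, b, h⟩
    refine ⟨(m⁻¹ : Kˣ) * a * k, (m⁻¹ : Kˣ) * b * l, ?_⟩
    rw [mul_smul, mul_smul, mul_smul, mul_smul, ← smul_add]
    rw [Units.smul_def, Units.smul_def, Units.smul_def] at h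
    rw [h, smul_smul]
    simp
  · rintro ⟨a, b, rfl⟩
    refine ⟨m * a * (k⁻¹ : Kˣ), m * b * (l⁻¹ : Kˣ), ?_⟩
    simp [Units.smul_def, mul_smul, smul_add]

theorem IsEmbedding.mem_closure_pair_iff (hφ : IsEmbedding (Lp p) M φ)
    {u v w : Fin 3 → ZMod p} (hu : u ≠ 0) (hv : v ≠ 0) (hw : w ≠ 0)
    (hu' : Projectivization.mk (ZMod p) u hu ∈ (Lp p).E)
    (hv' : Projectivization.mk (ZMod p) v hv ∈ (Lp p).E)
    (hw' : Projectivization.mk (ZMod p) w hw ∈ (Lp p).E) :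
    φ (Projectivization.mk (ZMod p) w hw) ∈ M.closure
      {φ (Projectivization.mk (ZMod p) u hu), φ (Projectivization.mk (ZMod p) v hv)} ↔
      ∃ a b : ZMod p, a • u + b • v = w := by
  rw [← rep_mem_span_iff hu hv hw]
  set P := Projectivization.mk (ZMod p) u hu
  set Q := Projectivization.mk (ZMod p) v hv
  set R := Projectivization.mk (ZMod p) w hw
  have hPQ : ({P, Q} : Set (ProjPlane p)) ⊆ (Lp p).E := by
    rintro x (rfl | rfl) <;> assumption
  have hli : LinearIndepOn (ZMod p) Projectivization.rep {P, Q} := by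
    have hinj : Function.Injective (Projectivization.rep : ProjPlane p → Fin 3 → ZMod p) :=
      fun x y h => by rw [← x.mk_rep, ← y.mk_rep]; simp only [h]
    rw [linearIndepOn_iff_image hinj.injOn, image_pair]
    exact Projectivization.linearIndepOn_pair P Q
  have hi : M.Indep {φ P, φ Q} := by
    rw [← image_pair, hφ.indep_iff _ hPQ, Lp_indep_iff hPQ]
    exact hli
  by_cases hR : R ∈ ({P, Q} : Set (ProjPlane p))
  · refine iff_of_true (M.mem_closure_of_mem' ?_ (hφ.mapsTo hw'))
      (Submodule.subset_span (mem_image_of_mem _ hR))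
    rw [← image_pair]
    exact mem_image_of_mem _ hR
  · have hRi : φ R ∉ ({φ P, φ Q} : Set α) := by
      rw [← image_pair]
      rwa [hφ.injOn.mem_image_iff hPQ hw']
    have h1 := hi.notMem_closure_iff_of_notMem hRi (hφ.mapsTo hw')
    rw [← image_pair, ← image_insert_eq, hφ.indep_iff _ (insert_subset hw' hPQ),
      Lp_indep_iff (insert_subset hw' hPQ), linearIndepOn_insert hR, image_pair] at h1
    rw [← not_iff_not, h1]
    exact and_iff_right hli

theorem ptA_mem (i : ZMod p) : ptA i ∈ (Lp p).E := Or.inl (Or.inl (Or.inl ⟨i, rfl⟩))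

theorem ptB_mem (i : ZMod p) : ptB i ∈ (Lp p).E := Or.inl (Or.inl (Or.inr ⟨i, rfl⟩))

theorem ptC_mem (i : ZMod p) : ptC i ∈ (Lp p).E := Or.inl (Or.inr ⟨i, rfl⟩)

theorem ptD_mem : ptD p ∈ (Lp p).E := Or.inr rfl

/-- The outer coordinates force the coefficients `v 2` and `v 0` on [0, i, 1] and [1, j, 0]; the
middle coordinate is then the line equation. -/
theorem IsEmbedding.rep (hφ : IsEmbedding (Lp p) M φ) {v : Fin 3 → ZMod p} (hv : v ≠ 0)
    (hv' : Projectivization.mk (ZMod p) v hv ∈ (Lp p).E) :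
    Rep M (fun i => φ (ptA i)) (fun i => φ (ptC i)) (φ (ptD p)) v
      (φ (Projectivization.mk (ZMod p) v hv)) where
  ne_zero := hv
  mem_ground := hφ.mapsTo hv'
  mem_line_iff j i := by
    rw [line, ptA, ptC, hφ.mem_closure_pair_iff _ _ hv (ptA_mem i) (ptC_mem j) hv']
    constructor
    · rintro ⟨a, b, rfl⟩
      simp
      ring
    · intro h
      refine ⟨v 2, v 0, ?_⟩
      ext k
      fin_cases k <;> simp [← h]
      ring
  eq_of_eq_zero h0 h2 := by
    congr 1
    refine (Projectivization.mk_eq_mk_iff' _ _ _ _ _).2 ⟨v 1, ?_⟩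
    ext k
    fin_cases k <;> simp [h0, h2]

theorem IsEmbedding.mem_closure_ptD (hφ : IsEmbedding (Lp p) M φ) {u v : Fin 3 → ZMod p}
    (hu : u ≠ 0) (hv : v ≠ 0) (hu' : Projectivization.mk (ZMod p) u hu ∈ (Lp p).E)
    (hv' : Projectivization.mk (ZMod p) v hv ∈ (Lp p).E) (h0 : u 0 = v 0) (h2 : u 2 = v 2) :
    φ (Projectivization.mk (ZMod p) v hv) ∈
      M.closure {φ (Projectivization.mk (ZMod p) u hu), φ (ptD p)} := by
  rw [ptD, hφ.mem_closure_pair_iff hu _ hv hu' ptD_mem hv']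
  refine ⟨1, v 1 - u 1, ?_⟩
  ext k
  fin_cases k <;> simp [h0, h2]

theorem IsEmbedding.frame (hφ : IsEmbedding (Lp p) M φ) :
    Frame M (fun i => φ (ptA i)) (fun i => φ (ptC i)) (φ (ptD p)) where
  repA i := hφ.rep _ (ptA_mem i)
  repC i := hφ.rep _ (ptC_mem i)
  repD := hφ.rep _ ptD_mem
  planeA i := hφ.mem_closure_ptD _ _ (ptA_mem 0) (ptA_mem i) rfl rfl
  planeC i := hφ.mem_closure_ptD _ _ (ptC_mem 0) (ptC_mem i) rfl rfl

end Embedding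
end HarmonicMatroid

theorem mainTheorem7 {α : Type*} (M : Matroid α) (hM : HarmonicMatroid.IsHarmonic M)
    (p : ℕ) [Fact p.Prime] (φ : HarmonicMatroid.ProjPlane p → α)
    (hφ : HarmonicMatroid.IsEmbedding (HarmonicMatroid.Lp p) M φ) (i j : ZMod p) :
    HarmonicMatroid.harmonicClosure M (φ '' HarmonicMatroid.lineLp j i) =
      M.closure (φ '' HarmonicMatroid.lineLp j i) ∩
        HarmonicMatroid.harmonicClosure M (φ '' (HarmonicMatroid.Lp p).E) := by
  open HarmonicMatroid in
  have hB : ∀ k, Rep M (fun i => φ (ptA i)) (fun i => φ (ptC i)) (φ (ptD p)) ![1, k, 1]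
      (φ (ptB k)) := fun k => hφ.rep _ (ptB_mem k)
  have key := hφ.frame.harmonicClosure_eq (B := fun i => φ (ptB i)) hM hB
    (hφ.frame.goodDir_of_family (by simp) hφ.frame.repA
      fun η η' => hφ.mem_closure_ptD _ _ (ptA_mem η) (ptA_mem η') rfl rfl)
    (hφ.frame.goodDir_of_family (by simp) hB
      fun η η' => hφ.mem_closure_ptD _ _ (ptB_mem η) (ptB_mem η') rfl rfl)
    (hφ.frame.goodDir_of_family (by simp) hφ.frame.repC
      fun η η' => hφ.mem_closure_ptD _ _ (ptC_mem η) (ptC_mem η') rfl rfl) j i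
  have hline : φ '' lineLp j i = {φ (ptA i), φ (ptB (i + j)), φ (ptC j)} := by
    rw [lineLp, image_insert_eq, image_pair]
  have hE : φ '' (Lp p).E = range (fun i : ZMod p => φ (ptA i)) ∪
      range (fun i : ZMod p => φ (ptB i)) ∪ range (fun i : ZMod p => φ (ptC i)) ∪ {φ (ptD p)} := by
    rw [Lp, Matroid.restrict_ground_eq, image_union, image_union, image_union, ← range_comp,
      ← range_comp, ← range_comp, image_singleton]
    rfl
  rw [hline, hE]
  exact key
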